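/- Let $\mathbb{K}$ be a field of characteristic zero. A \emph{multiquiver} is a quadruple $\Gamma=(V,E,s,t)$ where $V,E$ are sets and $s,t:E\to (V\times\mathbb{Z}_{>0})\cup\{\emptyset\}$ are functions such that (no loops) if $s(e)=(a,m)$ and $t(e)=(b,n)$ then $a\neq b$, and (local finiteness) for each $v\in V$ only finitely many edges $e$ satisfy $s(e)\in\{v\}\times\mathbb{Z}_{>0}$ or $t(e)\in\{v\}\times\mathbb{Z}_{>0}$; such edges are called incident to $v$. Its incidence matrix is the homomorphism $\gamma:\mathbb{Z}V\to\mathbb{Z}E$ of free abelian groups, \[\gamma(v)=\sum_{t(e)=(v,n)} n\,e-\sum_{s(e)=(v,n)} n\,e=\sum_{e\in E}\gamma_{ev}\,e .\] Let $R_E=\mathbb{K}[u_e\mid e\in E]$, let $\sigma_v$ ($v\in V$) be the automorphism of $R_E$ with $\sigma_v(u_e)=u_e-\gamma_{ev}$, and let $t_v=\prod_{e} u_{ev}$, the product over the edges incident to $v$, where $u_{ev}=u_e(u_e+1)\cdots(u_e+n-1)$ if $t(e)=(v,n)$ and $u_{ev}=(u_e-1)(u_e-2)\cdots(u_e-n)$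 if $s(e)=(v,n)$. Let $\mathcal{C}(\Gamma)$ be the $R_E$-ring generated by $X_v,Y_v$ ($v\in V$) with relations \[X_vr=\sigma_v(r)X_v,\quad Y_vr=\sigma_v^{-1}(r)Y_v,\quad Y_vX_v=t_v,\quad X_vY_v=\sigma_v(t_v),\quad X_vY_w=Y_wX_v\] for all $r\in R_E$ and $v,w\in V$, $v\ne w$ in the last relation. It is $\mathbb{Z}V$-graded by $\deg X_v=v$, $\deg Y_v=-v$, $\deg r=0$. The twisted generalized Weyl algebra $\mathcal{A}(\Gamma)$ is the quotient of $\mathcal{C}(\Gamma)$ by the sum of all graded two-sided ideals $J$ with $J\cap\mathcal{C}(\Gamma)_0=0$; it inherits the $\mathbb{Z}V$-grading $\mathcal{A}(\Gamma)=\bigoplus_{g\in\mathbb{Z}V}\mathcal{A}(\Gamma)_g$. Let $A_E(\mathbb{K})$ be the Weyl algebra, the $\mathbb{K}$-algebra generated by $x_e,y_e$ ($e\in E$) with relations $[x_e,x_f]=[y_e,y_f]=0$, $[y_e,x_f]=\delta_{ef}$, and $\mathbb{Z}E$-graded by $\deg x_e=e$, $\deg y_e=-e$. For $k=\sum_e k_e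 e\in\mathbb{Z}E$ put $z^k=\prod_{e\in E} z_e^{(k_e)}$ where $z_e^{(p)}=x_e^p$ if $p\ge 0$ and $z_e^{(p)}=y_e^{-p}$ if $p<0$. Let $\varphi_\Gamma:\mathcal{A}(\Gamma)\to A_E(\mathbb{K})$ be the (well-defined) $\mathbb{K}$-algebra homomorphism with \[\varphi_\Gamma(X_v)=z^{\gamma(v)},\quad \varphi_\Gamma(Y_v)=z^{-\gamma(v)}\quad(v\in V),\qquad \varphi_\Gamma(u_e)=y_ex_e\quad(e\in E).\] Then the following two statements are equivalent: (i) $\varphi_\Gamma$ is locally surjective, that is, $\varphi_\Gamma(\mathcal{A}(\Gamma)_g)=A_E(\mathbb{K})_{\gamma(g)}$ for all $g\in\mathbb{Z}V$; (ii) the underlying undirected graph of $\Gamma$ is acyclic, that is, there are no $n\ge 1$, pairwise distinct vertices $v_1,\dots,v_n$ and pairwise distinct edges $e_1,\dots,e_n$ such that for each $i$ the edge $e_i$ has one end at $v_i$ and the other at $v_{i+1}$, in either direction and with any multiplicities, where $v_{n+1}=v_1$. (In particular two edges between the same two vertices form a cycle.) -/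

import Mathlib

noncomputable section

namespace MultiquiverTGW

/-! ### Components of an algebra given by homogeneous generators -/

/-- The `K`-span of all words of total degree `d` in a family of generators `gen` with prescribed
degrees `deg`. -/
def gradedPart (K : Type*) {A G ι : Type*} [CommSemiring K] [Semiring A] [Algebra K A]
    [AddMonoid ι] (gen : G → A) (deg : G → ι) (d : ι) : Submodule K A :=
  Submodule.span K {a | ∃ l : List G, (l.map deg).sum = d ∧ (l.map gen).prod = a}

/-! ### Twisted generalized Weyl algebras -/

/-- A twisted generalized Weyl datum `(R, σ, t)` over `K` with index set `I`. -/
structure TGWDatum (K R I : Type*) [CommRing K] [Ring R] [Algebra K R] where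
  σ : I → (R ≃ₐ[K] R)
  σ_comm : ∀ i j, Commute (σ i) (σ j)
  t : I → R
  t_central : ∀ i, t i ∈ Subalgebra.center K R
  t_ne_zero : ∀ i, t i ≠ 0

/-- Generators of the twisted generalized Weyl construction. -/
inductive TGWGen (R I : Type*)
  | coeff (r : R)
  | X (i : I)
  | Y (i : I)

namespace TGWDatum

variable {K R I : Type*} [CommRing K] [Ring R] [Algebra K R]

/-- The defining relations. The first three say that `R` maps to the quotient by a homomorphism of
`K`-algebras, the others are the relations of the twisted generalized Weyl construction. -/
inductive Rel (D : TGWDatum K R I) (μ : I → I → K) :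
    FreeAlgebra K (TGWGen R I) → FreeAlgebra K (TGWGen R I) → Prop
  | coeff_add (r s : R) : Rel D μ (.ι K (.coeff (r + s))) (.ι K (.coeff r) + .ι K (.coeff s))
  | coeff_mul (r s : R) : Rel D μ (.ι K (.coeff (r * s))) (.ι K (.coeff r) * .ι K (.coeff s))
  | coeff_algebraMap (k : K) : Rel D μ (.ι K (.coeff (algebraMap K R k))) (algebraMap K _ k)
  | X_coeff (i : I) (r : R) :
      Rel D μ (.ι K (.X i) * .ι K (.coeff r)) (.ι K (.coeff (D.σ i r)) * .ι K (.X i))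
  | Y_coeff (i : I) (r : R) :
      Rel D μ (.ι K (.Y i) * .ι K (.coeff r)) (.ι K (.coeff ((D.σ i).symm r)) * .ι K (.Y i))
  | Y_X (i : I) : Rel D μ (.ι K (.Y i) * .ι K (.X i)) (.ι K (.coeff (D.t i)))
  | X_Y (i : I) : Rel D μ (.ι K (.X i) * .ι K (.Y i)) (.ι K (.coeff (D.σ i (D.t i))))
  | X_Y_ne (i j : I) (h : i ≠ j) :
      Rel D μ (.ι K (.X i) * .ι K (.Y j)) (μ i j • (.ι K (.Y j) * .ι K (.X i)))

/-- The twisted generalized Weyl construction `C_μ(R, σ, t)`: the `R`-ring generated by `X i`,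
`Y i` subject to the relations. -/
abbrev Construction (D : TGWDatum K R I) (μ : I → I → K) : Type _ := RingQuot (D.Rel μ)

/-- The generators as elements of the construction. -/
def gen (D : TGWDatum K R I) (μ : I → I → K) (a : TGWGen R I) : D.Construction μ :=
  RingQuot.mkAlgHom K (D.Rel μ) (.ι K a)

/-- Degrees of the generators: `deg (X i) = i`, `deg (Y i) = -i` and `deg r = 0`. -/
def genDeg : TGWGen R I → (I →₀ ℤ)
  | .coeff _ => 0
  | .X i => Finsupp.single i 1
  | .Y i => -Finsupp.single i 1

/-- The homogeneous component of degree `g` of the construction. -/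
def constructionPart (D : TGWDatum K R I) (μ : I → I → K) (g : I →₀ ℤ) :
    Submodule K (D.Construction μ) :=
  gradedPart K (D.gen μ) genDeg g

/-- A two-sided ideal is graded if each of its elements is a sum of homogeneous elements
of the ideal. -/
def IsGradedIdeal (D : TGWDatum K R I) (μ : I → I → K) (J : TwoSidedIdeal (D.Construction μ)) :
    Prop :=
  ∀ a ∈ J, a ∈ Submodule.span K {b | b ∈ J ∧ ∃ g, b ∈ D.constructionPart μ g}

/-- The sum of all graded ideals which have zero intersection with the degree zero component. -/
def radical (D : TGWDatum K R I) (μ : I → I → K) : TwoSidedIdeal (D.Construction μ) :=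
  sSup {J | D.IsGradedIdeal μ J ∧ ∀ a ∈ J, a ∈ D.constructionPart μ 0 → a = 0}

/-- The twisted generalized Weyl algebra `A_μ(R, σ, t)`. -/
abbrev Alg (D : TGWDatum K R I) (μ : I → I → K) : Type _ := (D.radical μ).ringCon.Quotient

/-- The quotient map from the construction to the twisted generalized Weyl algebra. -/
def toAlg (D : TGWDatum K R I) (μ : I → I → K) : D.Construction μ →ₐ[K] D.Alg μ :=
  (D.radical μ).ringCon.mkₐ K

/-- The homogeneous component of degree `g` of the twisted generalized Weyl algebra. -/
def algPart (D : TGWDatum K R I) (μ : I → I → K) (g : I →₀ ℤ) : Submodule K (D.Alg μ) :=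
  (D.constructionPart μ g).map (D.toAlg μ).toLinearMap

end TGWDatum

/-! ### The Weyl algebra -/

open scoped IsMulCommutative in
/-- Evaluation of polynomials at a family of commuting elements of a (noncommutative) algebra:
evaluation in the commutative subalgebra generated by them. -/
def aevalOfCommute (K : Type*) {E A : Type*} [CommSemiring K] [Semiring A] [Algebra K A]
    (f : E → A) (hf : ∀ i j, Commute (f i) (f j)) : MvPolynomial E K →ₐ[K] A :=
  haveI : IsMulCommutative (Algebra.adjoin K (Set.range f)) :=
    Algebra.isMulCommutative_adjoin K (by rintro _ ⟨i, rfl⟩ _ ⟨j, rfl⟩; exact hf i j)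
  (Algebra.adjoin K (Set.range f)).val.comp
    (MvPolynomial.aeval fun e => (⟨f e, Algebra.subset_adjoin ⟨e, rfl⟩⟩ :
      Algebra.adjoin K (Set.range f)))

open scoped IsMulCommutative in
theorem aevalOfCommute_X (K : Type*) {E A : Type*} [CommSemiring K] [Semiring A] [Algebra K A]
    (f : E → A) (hf : ∀ i j, Commute (f i) (f j)) (e : E) :
    aevalOfCommute K f hf (MvPolynomial.X e) = f e := by
  simp [aevalOfCommute]

/-- Generators of the Weyl algebra. -/
inductive WeylGen (E : Type*)
  | x (e : E)
  | y (e : E)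

/-- The defining relations `[x_i, x_j] = [y_i, y_j] = 0` and `[y_i, x_j] = δ_{ij}`. -/
inductive WeylRel (K E : Type*) [CommRing K] :
    FreeAlgebra K (WeylGen E) → FreeAlgebra K (WeylGen E) → Prop
  | x_x (i j : E) : WeylRel K E (.ι K (.x i) * .ι K (.x j)) (.ι K (.x j) * .ι K (.x i))
  | y_y (i j : E) : WeylRel K E (.ι K (.y i) * .ι K (.y j)) (.ι K (.y j) * .ι K (.y i))
  | y_x_self (i : E) : WeylRel K E (.ι K (.y i) * .ι K (.x i) - .ι K (.x i) * .ι K (.y i)) 1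
  | y_x_ne (i j : E) (h : i ≠ j) :
      WeylRel K E (.ι K (.y i) * .ι K (.x j) - .ι K (.x j) * .ι K (.y i)) 0

/-- The Weyl algebra over `K` with index set `E`. -/
abbrev Weyl (K E : Type*) [CommRing K] : Type _ := RingQuot (WeylRel K E)

namespace Weyl

section Basic

variable (K : Type*) {E : Type*} [CommRing K]

/-- The generators as elements of the Weyl algebra. -/
def gen (a : WeylGen E) : Weyl K E := RingQuot.mkAlgHom K (WeylRel K E) (.ι K a)

/-- The generator `x_e`. -/
def x (e : E) : Weyl K E := gen K (.x e)

/-- The generator `y_e`. -/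
def y (e : E) : Weyl K E := gen K (.y e)

/-- Degrees of the generators: `deg x_e = e` and `deg y_e = -e`. -/
def genDeg : WeylGen E → (E →₀ ℤ)
  | .x e => Finsupp.single e 1
  | .y e => -Finsupp.single e 1

/-- The homogeneous component of degree `k` of the Weyl algebra. -/
def part (k : E →₀ ℤ) : Submodule K (Weyl K E) := gradedPart K (gen K) genDeg k

theorem x_comm (i j : E) : Commute (x K i) (x K j) := by
  have := RingQuot.mkAlgHom_rel K (WeylRel.x_x (K := K) i j)
  rw [map_mul, map_mul] at this
  exact this

theorem y_comm (i j : E) : Commute (y K i) (y K j) := by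
  have := RingQuot.mkAlgHom_rel K (WeylRel.y_y (K := K) i j)
  rw [map_mul, map_mul] at this
  exact this

theorem y_mul_x (i : E) : y K i * x K i = x K i * y K i + 1 := by
  have := RingQuot.mkAlgHom_rel K (WeylRel.y_x_self (K := K) i)
  rw [map_sub, map_mul, map_mul, map_one, sub_eq_iff_eq_add'] at this
  exact this

theorem y_x_comm {i j : E} (h : i ≠ j) : Commute (y K i) (x K j) := by
  have := RingQuot.mkAlgHom_rel K (WeylRel.y_x_ne (K := K) i j h)
  rw [map_sub, map_mul, map_mul, map_zero, sub_eq_zero] at this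
  exact this

/-- The element `z_e^{(p)}`, equal to `x_e ^ p` if `p ≥ 0` and to `y_e ^ (-p)` if `p < 0`. -/
def zgen (e : E) : ℤ → Weyl K E
  | .ofNat n => x K e ^ n
  | .negSucc n => y K e ^ (n + 1)

theorem zgen_commute {i j : E} (h : i ≠ j) (p q : ℤ) : Commute (zgen K i p) (zgen K j q) := by
  cases p <;> cases q <;> simp only [zgen]
  · exact (x_comm K i j).pow_pow _ _
  · exact (y_x_comm K h.symm).symm.pow_pow _ _
  · exact (y_x_comm K h).pow_pow _ _
  · exact (y_comm K i j).pow_pow _ _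

theorem zgen_pairwise (s : Finset E) (k : E → ℤ) :
    (s : Set E).Pairwise (Function.onFun Commute fun e => zgen K e (k e)) :=
  fun _ _ _ _ h => zgen_commute K h _ _

/-- The element `z^k = ∏ z_e^{(k_e)}`; the factors commute with each other. -/
def z (k : E →₀ ℤ) : Weyl K E :=
  k.support.noncommProd (fun e => zgen K e (k e)) (zgen_pairwise K _ _)

theorem z_zero : z K (0 : E →₀ ℤ) = 1 := by
  rw [z]
  exact Finset.noncommProd_empty _ _

/-- The element `u_e = y_e x_e`. -/
def u (e : E) : Weyl K E := y K e * x K e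

theorem u_zgen_commute {i j : E} (h : i ≠ j) (p : ℤ) : Commute (u K i) (zgen K j p) := by
  have h1 := zgen_commute K h (-1) p
  have h2 := zgen_commute K h 1 p
  rw [show zgen K i (-1) = y K i from pow_one _] at h1
  rw [show zgen K i 1 = x K i from pow_one _] at h2
  exact h1.mul_left h2

theorem u_comm (i j : E) : Commute (u K i) (u K j) := by
  by_cases h : i = j
  · subst h; exact Commute.refl _
  have h1 := u_zgen_commute K h (-1)
  have h2 := u_zgen_commute K h 1
  rw [show zgen K j (-1) = y K j from pow_one _] at h1
  rw [show zgen K j 1 = x K j from pow_one _] at h2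
  exact h1.mul_right h2

/-- The structure map `K[u_e | e ∈ E] → A_E(K)`, `u_e ↦ y_e x_e`. -/
def coeff : MvPolynomial E K →ₐ[K] Weyl K E := aevalOfCommute K (u K) (u_comm K)

@[simp]
theorem coeff_X (e : E) : coeff K (MvPolynomial.X e) = u K e := by
  exact aevalOfCommute_X K _ _ e

/-- The automorphism of the polynomial ring given by `u_e ↦ u_e - c_e`. -/
def shift (c : E → ℤ) : MvPolynomial E K →ₐ[K] MvPolynomial E K :=
  MvPolynomial.aeval fun e => MvPolynomial.X e - (c e : MvPolynomial E K)

@[simp]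
theorem shift_X (c : E → ℤ) (e : E) :
    shift K c (MvPolynomial.X e) = MvPolynomial.X e - (c e : MvPolynomial E K) := by
  simp [shift]

theorem shift_comp (c d : E → ℤ) : (shift K c).comp (shift K d) = shift K (c + d) := by
  apply MvPolynomial.algHom_ext
  intro e
  simp only [AlgHom.comp_apply, shift_X, map_sub, map_intCast, Pi.add_apply, Int.cast_add]
  ring

theorem shift_zero : shift K (0 : E → ℤ) = AlgHom.id K _ := by
  apply MvPolynomial.algHom_ext
  intro e
  simp

/-- `shift` as an automorphism. -/
def shiftEquiv (c : E → ℤ) : MvPolynomial E K ≃ₐ[K] MvPolynomial E K :=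
  AlgEquiv.ofAlgHom (shift K c) (shift K (-c)) (by simp [shift_comp, shift_zero])
    (by simp [shift_comp, shift_zero])

/-- The polynomial `f` with `z_e^{(-p)} z_e^{(p)} = f(u_e)`: it is `u_e (u_e + 1) ⋯ (u_e + p - 1)`
if `p ≥ 0` and `(u_e - 1) ⋯ (u_e - |p|)` if `p < 0`. -/
def factor (e : E) : ℤ → MvPolynomial E K
  | .ofNat n => ∏ i ∈ Finset.range n, (MvPolynomial.X e + (i : MvPolynomial E K))
  | .negSucc n => ∏ i ∈ Finset.range (n + 1), (MvPolynomial.X e - ((i + 1 : ℕ) : MvPolynomial E K))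

theorem x_mul_y (e : E) : x K e * y K e = u K e - 1 := by
  rw [u, y_mul_x]; simp

theorem x_pow_u (e : E) (n : ℕ) : x K e ^ n * u K e = (u K e - n) * x K e ^ n := by
  induction n with
  | zero => simp
  | succ n ih =>
    have h : x K e * u K e = (u K e - 1) * x K e := by
      rw [← x_mul_y, u, mul_assoc]
    rw [pow_succ, mul_assoc, h, ← mul_assoc, mul_sub, ih, Nat.cast_succ, ← sub_sub, sub_mul _ 1,
      one_mul, ← mul_assoc, sub_mul (_ * _), mul_one, mul_assoc (u K e - (n : Weyl K E))]

theorem y_pow_u (e : E) (n : ℕ) : y K e ^ n * u K e = (u K e + n) * y K e ^ n := by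
  induction n with
  | zero => simp
  | succ n ih =>
    have h : y K e * u K e = (u K e + 1) * y K e := by
      have : u K e * y K e = y K e * (u K e - 1) := by rw [← x_mul_y, u, mul_assoc]
      rw [add_mul, this, mul_sub, mul_one, one_mul, sub_add_cancel]
    rw [pow_succ, mul_assoc, h, ← mul_assoc, mul_add, ih, Nat.cast_succ, ← add_assoc, add_mul _ 1,
      one_mul, ← mul_assoc, add_mul (_ * _), mul_one, mul_assoc (u K e + (n : Weyl K E))]

theorem zgen_mul_u (e : E) (p : ℤ) : zgen K e p * u K e = (u K e - p) * zgen K e p := by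
  cases p with
  | ofNat n => simpa [zgen] using x_pow_u K e n
  | negSucc n =>
    have := y_pow_u K e (n + 1)
    simp only [zgen, this, Int.cast_negSucc, sub_neg_eq_add]

theorem y_pow_x_pow (e : E) (n : ℕ) : y K e ^ n * x K e ^ n =
    coeff K (∏ i ∈ Finset.range n, (MvPolynomial.X e + (i : MvPolynomial E K))) := by
  induction n with
  | zero => simp
  | succ n ih =>
    rw [Finset.prod_range_succ_comm, map_mul, ← ih, map_add, map_natCast, coeff_X, ← mul_assoc,
      ← y_pow_u, pow_succ, pow_succ', u]
    simp only [mul_assoc]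

theorem x_pow_y_pow (e : E) (n : ℕ) : x K e ^ n * y K e ^ n =
    coeff K (∏ i ∈ Finset.range n, (MvPolynomial.X e - ((i + 1 : ℕ) : MvPolynomial E K))) := by
  induction n with
  | zero => simp
  | succ n ih =>
    have h : (u K e - ((n + 1 : ℕ) : Weyl K E)) * x K e ^ n = x K e ^ n * (u K e - 1) := by
      rw [mul_sub, x_pow_u, Nat.cast_succ, ← sub_sub, sub_mul _ 1, one_mul, mul_one]
    rw [Finset.prod_range_succ_comm, map_mul, ← ih, map_sub, map_natCast, coeff_X, ← mul_assoc,
      h, ← x_mul_y, pow_succ, pow_succ']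
    simp only [mul_assoc]

theorem zgen_neg_mul_zgen (e : E) (p : ℤ) :
    zgen K e (-p) * zgen K e p = coeff K (factor K e p) := by
  cases p with
  | ofNat n =>
    have : zgen K e (-(Int.ofNat n)) = y K e ^ n := by
      cases n with
      | zero => exact (pow_zero _).trans (pow_zero _).symm
      | succ n => rfl
    rw [this]
    exact y_pow_x_pow K e n
  | negSucc n => exact x_pow_y_pow K e (n + 1)

theorem shift_factor (c : E → ℤ) (e : E) :
    shift K c (factor K e (c e)) = factor K e (-(c e)) := by
  generalize hp : c e = p
  cases p with
  | ofNat n =>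
    have : factor K e (-(Int.ofNat n)) =
        ∏ i ∈ Finset.range n, (MvPolynomial.X e - ((i + 1 : ℕ) : MvPolynomial E K)) := by
      cases n with
      | zero => rfl
      | succ n => rfl
    rw [this, ← Finset.prod_range_reflect]
    simp only [factor, map_prod, map_add, map_natCast, shift_X, hp]
    refine Finset.prod_congr rfl fun i hi => ?_
    have hi := Finset.mem_range.1 hi
    rw [show n - 1 - i + 1 = n - i by omega, Nat.cast_sub hi.le]
    simp only [Int.ofNat_eq_natCast, Int.cast_natCast]
    ring
  | negSucc n =>
    change _ = ∏ i ∈ Finset.range (n + 1), (MvPolynomial.X e + (i : MvPolynomial E K))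
    rw [← Finset.prod_range_reflect]
    simp only [factor, map_prod, map_sub, map_natCast, shift_X, hp]
    refine Finset.prod_congr rfl fun i hi => ?_
    have hi := Finset.mem_range.1 hi
    rw [show n + 1 - 1 - i = n - i by omega, Nat.cast_sub (by omega)]
    simp only [Int.cast_negSucc]
    push_cast
    ring

open Classical in
theorem noncommProd_mul_u (s : Finset E) (k : E → ℤ) (h) (e : E) :
    s.noncommProd (fun e => zgen K e (k e)) h * u K e =
      (u K e - ((if e ∈ s then k e else 0 : ℤ) : Weyl K E)) *
        s.noncommProd (fun e => zgen K e (k e)) h := by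
  induction s using Finset.induction_on with
  | empty => simp
  | insert a s ha ih =>
    rw [Finset.noncommProd_insert_of_notMem _ _ _ _ ha, mul_assoc, ih]
    by_cases hae : e = a
    · subst hae
      simp only [ha, if_false, Int.cast_zero, sub_zero, Finset.mem_insert_self, if_true]
      rw [← mul_assoc, zgen_mul_u, mul_assoc]
    · have hc : Commute (zgen K a (k a)) (u K e) := (u_zgen_commute K hae _).symm
      have hc2 : Commute (zgen K a (k a)) (u K e - ((if e ∈ s then k e else 0 : ℤ) : Weyl K E)) :=
        hc.sub_right (Int.cast_commute _ _).symm
      rw [← mul_assoc, hc2.eq, mul_assoc]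
      simp [hae]

theorem z_mul_coeff (k : E →₀ ℤ) (r : MvPolynomial E K) :
    z K k * coeff K r = coeff K (shift K k r) * z K k := by
  induction r using MvPolynomial.induction_on with
  | C a =>
    rw [← MvPolynomial.algebraMap_eq, AlgHom.commutes, AlgHom.commutes, AlgHom.commutes]
    exact (Algebra.commutes _ _).symm
  | add p q hp hq => simp only [map_add, mul_add, add_mul, hp, hq]
  | mul_X p e hp =>
    rw [map_mul, map_mul, ← mul_assoc, hp, mul_assoc, coeff_X, map_mul, mul_assoc]
    congr 1
    rw [shift_X, map_sub, coeff_X, map_intCast, z, noncommProd_mul_u]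
    congr 3
    simp +contextual [eq_comm]

theorem z_neg_mul_z (k : E →₀ ℤ) :
    z K (-k) * z K k = coeff K (∏ e ∈ k.support, factor K e (k e)) := by
  have h1 : z K (-k) = k.support.noncommProd (fun e => zgen K e (-(k e)))
      (zgen_pairwise K _ fun e => -(k e)) :=
    Finset.noncommProd_congr (Finsupp.support_neg k) (fun _ _ => rfl) _
  rw [h1, z, ← Finset.noncommProd_mul_distrib]
  · rw [← Finset.noncommProd_eq_prod]
    exact (Finset.noncommProd_congr rfl (fun e _ => zgen_neg_mul_zgen K e (k e)) _).trans
      (Finset.map_noncommProd k.support (fun e => factor K e (k e))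
        (fun _ _ _ _ _ => Commute.all _ _) (coeff K)).symm
  · exact fun _ _ _ _ h => zgen_commute K h _ _

theorem z_mul_z_neg (k : E →₀ ℤ) :
    z K k * z K (-k) = coeff K (shift K k (∏ e ∈ k.support, factor K e (k e))) := by
  have := z_neg_mul_z K (-k)
  rw [neg_neg] at this
  rw [this, map_prod (shift K k), Finsupp.support_neg]
  congr 1
  exact Finset.prod_congr rfl fun e _ => (shift_factor K k e).symm

theorem zgen_commute_of_mul_nonneg (e : E) {p q : ℤ} (h : 0 ≤ p * q) :
    Commute (zgen K e p) (zgen K e q) := by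
  cases p with
  | ofNat m => cases q with
    | ofNat n => exact (Commute.refl _).pow_pow _ _
    | negSucc n =>
      cases m with
      | zero => simp [zgen]
      | succ m => exact absurd h (not_le.2 (mul_neg_of_pos_of_neg (Int.natCast_succ_pos m)
          (Int.negSucc_lt_zero n)))
  | negSucc m => cases q with
    | negSucc n => exact (Commute.refl _).pow_pow _ _
    | ofNat n =>
      cases n with
      | zero => simp [zgen]
      | succ n => exact absurd h (not_le.2 (mul_neg_of_neg_of_pos (Int.negSucc_lt_zero m)
          (Int.natCast_succ_pos n)))

theorem z_commute_of_mul_nonneg {k l : E →₀ ℤ} (h : ∀ e, 0 ≤ k e * l e) :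
    Commute (z K k) (z K l) := by
  refine Finset.noncommProd_commute _ _ _ _ fun i _ => (Finset.noncommProd_commute _ _ _ _
    fun j _ => ?_).symm
  by_cases hij : i = j
  · subst hij; exact (zgen_commute_of_mul_nonneg K i (h i)).symm
  · exact zgen_commute K hij _ _

/-! The homogeneous components of the Weyl algebra consist of the elements `f(u) z^k`, and
`f(u) z^k w = 0` implies `f = 0` for each word `w`. -/

theorem z_split (k : E →₀ ℤ) (e : E) : z K k = zgen K e (k e) * z K (k.erase e) := by
  classical
  by_cases he : e ∈ k.support
  · rw [z, ← Finset.mul_noncommProd_erase k.support he]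
    congr 1
    exact Finset.noncommProd_congr (Finsupp.support_erase).symm
      (fun i hi => by rw [Finsupp.erase_ne (by rintro rfl; simp at hi)]) _
  · rw [Finsupp.erase_of_notMem_support he, Finsupp.notMem_support_iff.1 he]
    simp [zgen]

theorem x_mul_z (k : E →₀ ℤ) (e : E) :
    ∃ q, x K e * z K k = coeff K q * z K (Finsupp.single e 1 + k) := by
  have h : (Finsupp.single e 1 + k).erase e = k.erase e := by
    rw [Finsupp.erase_add, Finsupp.erase_single, zero_add]
  rw [z_split K k e, z_split K (Finsupp.single e 1 + k) e, h, ← mul_assoc, Finsupp.add_apply,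
    Finsupp.single_eq_same]
  generalize k e = p
  cases p with
  | ofNat n =>
    refine ⟨1, ?_⟩
    rw [show (1 : ℤ) + Int.ofNat n = Int.ofNat (n + 1) by simp [add_comm]]
    simp only [zgen, map_one, one_mul, pow_succ']
  | negSucc n =>
    refine ⟨MvPolynomial.X e - 1, ?_⟩
    have : zgen K e (1 + Int.negSucc n) = y K e ^ n := by
      cases n with
      | zero => simp [zgen, Int.negSucc_eq]
      | succ n =>
        rw [show (1 : ℤ) + Int.negSucc (n + 1) = Int.negSucc n by simp [Int.negSucc_eq]]
        rfl
    rw [this, zgen, pow_succ', ← mul_assoc (x K e), x_mul_y, map_sub, coeff_X, map_one]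
    simp only [mul_assoc]

theorem y_mul_z (k : E →₀ ℤ) (e : E) :
    ∃ q, y K e * z K k = coeff K q * z K (-Finsupp.single e 1 + k) := by
  have h : (-Finsupp.single e 1 + k).erase e = k.erase e := by
    rw [Finsupp.erase_add, ← Finsupp.single_neg, Finsupp.erase_single, zero_add]
  rw [z_split K k e, z_split K (-Finsupp.single e 1 + k) e, h, ← mul_assoc, Finsupp.add_apply,
    Finsupp.neg_apply, Finsupp.single_eq_same]
  generalize k e = p
  cases p with
  | ofNat n =>
    cases n with
    | zero => 
      refine ⟨1, ?_⟩
      rw [show (-1 : ℤ) + Int.ofNat 0 = Int.negSucc 0 from rfl]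
      simp [zgen]
    | succ n =>
      refine ⟨MvPolynomial.X e, ?_⟩
      rw [show (-1 : ℤ) + Int.ofNat (n + 1) = Int.ofNat n by simp]
      simp only [zgen, coeff_X, u, pow_succ', mul_assoc]
  | negSucc n =>
    refine ⟨1, ?_⟩
    rw [show (-1 : ℤ) + Int.negSucc n = Int.negSucc (n + 1) by simp [Int.negSucc_eq]]
    simp only [zgen, map_one, one_mul, pow_succ', mul_assoc]

theorem gen_mul_z (g : WeylGen E) (k : E →₀ ℤ) :
    ∃ q, gen K g * z K k = coeff K q * z K (genDeg g + k) := by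
  cases g with
  | x e => exact x_mul_z K k e
  | y e => exact y_mul_z K k e

/-- A generator can be moved to the right past coefficients, at the cost of changing them. -/
theorem gen_mul_coeff (g : WeylGen E) (r : MvPolynomial E K) :
    ∃ r', gen K g * coeff K r = coeff K r' * gen K g := by
  have h : gen K g = z K (genDeg g) := by
    cases g with
    | x e =>
      rw [genDeg, z_split K _ e, Finsupp.single_eq_same, Finsupp.erase_single]
      simp [z_zero, show zgen K e 1 = x K e from pow_one _, x]
    | y e =>
      rw [genDeg, z_split K _ e, ← Finsupp.single_neg, Finsupp.single_eq_same, Finsupp.erase_single]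
      simp [z_zero, show zgen K e (-1) = y K e from pow_one _, y]
  rw [h]
  exact ⟨_, z_mul_coeff K _ r⟩

theorem word_eq (l : List (WeylGen E)) :
    ∃ q, (l.map (gen K)).prod = coeff K q * z K (l.map genDeg).sum := by
  induction l with
  | nil => exact ⟨1, by simp [z_zero]⟩
  | cons g l ih =>
    obtain ⟨q, hq⟩ := ih
    obtain ⟨q', hq'⟩ := gen_mul_coeff K g q
    obtain ⟨r, hr⟩ := gen_mul_z K g (l.map genDeg).sum
    refine ⟨q' * r, ?_⟩
    rw [List.map_cons, List.prod_cons, hq, ← mul_assoc, hq', mul_assoc, hr, List.map_cons,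
      List.sum_cons, map_mul, mul_assoc]

theorem exists_eq_of_mem_part {k : E →₀ ℤ} {a : Weyl K E} (ha : a ∈ part K k) :
    ∃ q, a = coeff K q * z K k := by
  induction ha using Submodule.span_induction with
  | mem a h =>
    obtain ⟨l, hl, rfl⟩ := h
    rw [← hl]
    exact word_eq K l
  | zero => exact ⟨0, by simp⟩
  | add a b _ _ ha hb =>
    obtain ⟨p, rfl⟩ := ha
    obtain ⟨q, rfl⟩ := hb
    exact ⟨p + q, by rw [map_add, add_mul]⟩
  | smul c a _ ha =>
    obtain ⟨p, rfl⟩ := ha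
    exact ⟨c • p, by rw [map_smul, smul_mul_assoc]⟩

/-- The action of the Weyl algebra on `K[u_e | e ∈ E]` where `x_e` acts by the shift
`u_e ↦ u_e - 1`, and `y_e` by the inverse shift followed by multiplication by `u_e`. -/
def rep : Weyl K E →ₐ[K] Module.End K (MvPolynomial E K) :=
  RingQuot.liftAlgHom K ⟨FreeAlgebra.lift K fun
    | .x e => (shift K (Finsupp.single e 1)).toLinearMap
    | .y e => (LinearMap.mulLeft K (MvPolynomial.X e)).comp
        (shift K (-(Finsupp.single e 1 : E →₀ ℤ) : E →₀ ℤ)).toLinearMap, by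
    intro a b h
    have hs (c d : E → ℤ) (r : MvPolynomial E K) : shift K c (shift K d r) = shift K (c + d) r := by
      rw [← shift_comp]; rfl
    cases h with
    | x_x i j =>
      refine LinearMap.ext fun r => ?_
      simp [hs, add_comm]
    | y_y i j =>
      refine LinearMap.ext fun r => ?_
      by_cases hij : i = j
      · subst hij; rfl
      · simp [hs, add_comm, Ne.symm hij, hij]
        ring
    | y_x_self i =>
      refine LinearMap.ext fun r => ?_
      simp [hs, shift_zero]
      ring
    | y_x_ne i j hij =>
      refine LinearMap.ext fun r => ?_
      simp [hs, hij, add_comm]⟩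

theorem rep_coeff (p r : MvPolynomial E K) : rep K (coeff K p) r = p * r := by
  have : (rep K).comp (coeff K) = Algebra.lmul K (MvPolynomial E K) := by
    apply MvPolynomial.algHom_ext
    intro e
    refine LinearMap.ext fun r => ?_
    have hs (c d : E → ℤ) (r : MvPolynomial E K) : shift K c (shift K d r) = shift K (c + d) r := by
      rw [← shift_comp]; rfl
    simp [u, x, y, gen, rep, hs, shift_zero]
  exact LinearMap.congr_fun (DFunLike.congr_fun this p) r

theorem shift_injective (c : E → ℤ) : Function.Injective (shift K c) :=
  (shiftEquiv K c).injective

theorem rep_x_injective (e : E) : Function.Injective (rep K (x K e)) := by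
  have : (rep K (x K e) : MvPolynomial E K → MvPolynomial E K) =
      shift K (Finsupp.single e 1 : E →₀ ℤ) := by
    funext r; simp [x, gen, rep]
  rw [this]
  exact shift_injective K _

theorem rep_y_injective [IsDomain K] (e : E) : Function.Injective (rep K (y K e)) := by
  have : (rep K (y K e) : MvPolynomial E K → MvPolynomial E K) =
      fun r => MvPolynomial.X e * shift K (-(Finsupp.single e 1 : E →₀ ℤ) : E →₀ ℤ) r := by
    funext r; simp [y, gen, rep]
  rw [this]
  exact (mul_right_injective₀ (MvPolynomial.X_ne_zero e)).comp (shift_injective K _)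

theorem rep_z_injective [IsDomain K] (k : E →₀ ℤ) : Function.Injective (rep K (z K k)) := by
  have hpow (f : Module.End K (MvPolynomial E K)) (hf : Function.Injective f) (n : ℕ) :
      Function.Injective (f ^ n : Module.End K (MvPolynomial E K)) := by
    rw [Module.End.coe_pow]
    exact hf.iterate n
  refine Finset.noncommProd_induction _ _ _ (fun a => Function.Injective (rep K a)) ?_ ?_ ?_
  · intro a b ha hb
    rw [map_mul]
    exact ha.comp hb
  · rw [map_one]
    exact Function.injective_id
  · intro e _
    cases k e with
    | ofNat n => rw [zgen, map_pow]; exact hpow _ (rep_x_injective K e) n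
    | negSucc n => rw [zgen, map_pow]; exact hpow _ (rep_y_injective K e) (n + 1)

theorem eq_zero_of_mul_eq_zero [IsDomain K] {k : E →₀ ℤ} {a b : Weyl K E} (ha : a ∈ part K k)
    (hb : Function.Injective (rep K b)) (h : a * b = 0) : a = 0 := by
  obtain ⟨q, rfl⟩ := exists_eq_of_mem_part K ha
  have h1 : rep K (coeff K q * z K k * b) 1 = q * rep K (z K k) (rep K b 1) := by
    rw [map_mul, map_mul, Module.End.mul_apply, Module.End.mul_apply, rep_coeff]
  rw [h, map_zero, LinearMap.zero_apply] at h1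
  have h2 : rep K (z K k) (rep K b 1) ≠ 0 := by
    intro h0
    have h3 := hb (((rep_z_injective K k) (h0.trans (map_zero _).symm)).trans (map_zero _).symm)
    exact one_ne_zero h3
  rw [(mul_eq_zero.1 h1.symm).resolve_right h2, map_zero, zero_mul]

theorem x_mem_part (e : E) : x K e ∈ part K (Finsupp.single e 1 : E →₀ ℤ) :=
  Submodule.subset_span ⟨[.x e], by simp [genDeg], by simp [x]⟩

theorem y_mem_part (e : E) : y K e ∈ part K (-Finsupp.single e 1 : E →₀ ℤ) :=
  Submodule.subset_span ⟨[.y e], by simp [genDeg], by simp [y]⟩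

end Basic

end Weyl

theorem one_mem_gradedPart {K A G ι : Type*} [CommSemiring K] [Semiring A] [Algebra K A]
    [AddMonoid ι] (gen : G → A) (deg : G → ι) : 1 ∈ gradedPart K gen deg 0 :=
  Submodule.subset_span ⟨[], by simp, by simp⟩

theorem mul_mem_gradedPart {K A G ι : Type*} [CommSemiring K] [Semiring A] [Algebra K A]
    [AddMonoid ι] (gen : G → A) (deg : G → ι) {d d' : ι} {a b : A}
    (ha : a ∈ gradedPart K gen deg d) (hb : b ∈ gradedPart K gen deg d') :
    a * b ∈ gradedPart K gen deg (d + d') := by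
  have h := Submodule.mul_mem_mul ha hb
  rw [gradedPart, gradedPart, Submodule.span_mul_span] at h
  refine Submodule.span_mono ?_ h
  rintro _ ⟨_, ⟨l, hl, rfl⟩, _, ⟨l', hl', rfl⟩, rfl⟩
  exact ⟨l ++ l', by simp [hl, hl'], by simp⟩

namespace Weyl

variable (K : Type*) {E : Type*} [CommRing K]

theorem coeff_mem_part (r : MvPolynomial E K) : coeff K r ∈ part K (0 : E →₀ ℤ) := by
  induction r using MvPolynomial.induction_on with
  | C a =>
    rw [← MvPolynomial.algebraMap_eq, AlgHom.commutes, Algebra.algebraMap_eq_smul_one]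
    exact Submodule.smul_mem _ _ (one_mem_gradedPart _ _)
  | add p q hp hq => rw [map_add]; exact add_mem hp hq
  | mul_X p e hp =>
    rw [map_mul, coeff_X, u]
    have := mul_mem_gradedPart _ _ hp (mul_mem_gradedPart _ _ (y_mem_part K e) (x_mem_part K e))
    simpa [part] using this

theorem zgen_mem_part (e : E) (p : ℤ) : zgen K e p ∈ part K (Finsupp.single e p : E →₀ ℤ) := by
  have hx (n : ℕ) : x K e ^ n ∈ part K (Finsupp.single e (n : ℤ) : E →₀ ℤ) := by
    induction n with
    | zero => simpa [part] using one_mem_gradedPart (gen K) genDeg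
    | succ n ih =>
      rw [pow_succ, Nat.cast_succ, Finsupp.single_add]
      exact mul_mem_gradedPart _ _ ih (x_mem_part K e)
  have hy (n : ℕ) : y K e ^ n ∈ part K (Finsupp.single e (-(n : ℤ)) : E →₀ ℤ) := by
    induction n with
    | zero => simpa [part] using one_mem_gradedPart (gen K) genDeg
    | succ n ih =>
      rw [pow_succ, Nat.cast_succ, neg_add, Finsupp.single_add, Finsupp.single_neg e (1 : ℤ)]
      exact mul_mem_gradedPart _ _ ih (y_mem_part K e)
  cases p with
  | ofNat n => exact hx n
  | negSucc n => exact hy (n + 1)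

theorem z_mem_part (k : E →₀ ℤ) : z K k ∈ part K k := by
  classical
  induction k using Finsupp.induction with
  | zero => rw [z_zero]; exact one_mem_gradedPart _ _
  | single_add e p k hk _ ih =>
    have h : (Finsupp.single e p + k).erase e = k := by
      rw [Finsupp.erase_add, Finsupp.erase_single, zero_add, Finsupp.erase_of_notMem_support hk]
    rw [z_split K _ e, h, Finsupp.add_apply, Finsupp.notMem_support_iff.1 hk, add_zero,
      Finsupp.single_eq_same]
    exact mul_mem_gradedPart _ _ (zgen_mem_part K e p) ih

end Weyl

/-! ### Multiquivers -/

/-- A multiquiver with vertex set `V` and edge set `E`. The value `none` means that the edge has no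
source (respectively no target). -/
structure Multiquiver (V E : Type*) where
  s : E → Option (V × ℕ+)
  t : E → Option (V × ℕ+)
  no_loops : ∀ e a b m n, s e = some (a, m) → t e = some (b, n) → a ≠ b
  finite_s : ∀ v, {e | ∃ n, s e = some (v, n)}.Finite
  finite_t : ∀ v, {e | ∃ n, t e = some (v, n)}.Finite

namespace Multiquiver

variable {V E : Type*} (Γ : Multiquiver V E)

open Classical in
/-- The multiplicity at the vertex `v` of an edge end `o`; it is zero if the end is not at `v`. -/
def mult : Option (V × ℕ+) → V → ℕ
  | some (w, n), v => if w = v then (n : ℕ) else 0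
  | none, _ => 0

theorem mult_ne_zero {o : Option (V × ℕ+)} {v : V} : mult o v ≠ 0 ↔ ∃ n, o = some (v, n) := by
  rcases o with _ | ⟨w, n⟩
  · simp [mult]
  · by_cases h : w = v <;> simp [mult, h]

/-- The set of edges incident to `v`. -/
def incident (v : V) : Set E := {e | ∃ n, Γ.s e = some (v, n)} ∪ {e | ∃ n, Γ.t e = some (v, n)}

theorem finite_incident (v : V) : (Γ.incident v).Finite := (Γ.finite_s v).union (Γ.finite_t v)

/-- The matrix entry `γ_{ev}`. -/
def entry (e : E) (v : V) : ℤ := (mult (Γ.t e) v : ℤ) - (mult (Γ.s e) v : ℤ)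

theorem entry_support_finite (v : V) : (Function.support fun e => Γ.entry e v).Finite := by
  refine (Γ.finite_incident v).subset fun e he => ?_
  by_contra h
  simp only [incident, Set.mem_union, Set.mem_ofPred_eq, ← mult_ne_zero, not_or, not_not] at h
  exact he (by simp [entry, h.1, h.2])

/-- The column `γ(v) ∈ ℤE` of the incidence matrix. -/
def col (v : V) : E →₀ ℤ :=
  Finsupp.ofSupportFinite (fun e => Γ.entry e v) (Γ.entry_support_finite v)

/-- The incidence matrix `γ : ℤV → ℤE`. -/
def γ : (V →₀ ℤ) →ₗ[ℤ] (E →₀ ℤ) := Finsupp.linearCombination ℤ Γ.col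

/-- The polynomial `u_{ev}`: it is `u_e (u_e + 1) ⋯ (u_e + n - 1)` if `t(e) = (v, n)` and
`(u_e - 1) (u_e - 2) ⋯ (u_e - n)` if `s(e) = (v, n)`. At most one of the two factors below is
different from `1`. -/
def uev (K : Type*) [CommRing K] (e : E) (v : V) : MvPolynomial E K :=
  (∏ i ∈ Finset.range (mult (Γ.t e) v), (MvPolynomial.X e + (i : MvPolynomial E K))) *
    ∏ i ∈ Finset.range (mult (Γ.s e) v), (MvPolynomial.X e - ((i + 1 : ℕ) : MvPolynomial E K))

/-- The element `t_v`, the product of the `u_{ev}` over the edges `e` incident to `v`. -/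
def tv (K : Type*) [CommRing K] (v : V) : MvPolynomial E K :=
  ∏ e ∈ (Γ.finite_incident v).toFinset, Γ.uev K e v

theorem mult_t_eq_zero_or (e : E) (v : V) : mult (Γ.t e) v = 0 ∨ mult (Γ.s e) v = 0 := by
  by_contra h
  rw [not_or] at h
  obtain ⟨n, hn⟩ := mult_ne_zero.1 h.1
  obtain ⟨m, hm⟩ := mult_ne_zero.1 h.2
  exact Γ.no_loops e v v m n hm hn rfl

theorem uev_eq_factor (K : Type*) [CommRing K] (e : E) (v : V) :
    Γ.uev K e v = Weyl.factor K e (Γ.entry e v) := by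
  rcases Γ.mult_t_eq_zero_or e v with h | h
  · rw [uev, entry, h]
    cases mult (Γ.s e) v with
    | zero =>
      change _ = Weyl.factor K e (Int.ofNat 0)
      simp [Weyl.factor]
    | succ n =>
      rw [show ((0 : ℕ) : ℤ) - ((n + 1 : ℕ) : ℤ) = Int.negSucc n by simp [Int.negSucc_eq]]
      simp [Weyl.factor]
  · rw [uev, entry, h]
    simp [Weyl.factor]

theorem col_support (v : V) : (Γ.col v).support = (Γ.finite_incident v).toFinset := by
  ext e
  simp only [Finsupp.mem_support_iff, Set.Finite.mem_toFinset, incident, Set.mem_union,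
    Set.mem_ofPred_eq, ← mult_ne_zero]
  change Γ.entry e v ≠ 0 ↔ _
  rcases Γ.mult_t_eq_zero_or e v with h | h <;> simp [entry, h]

theorem tv_eq (K : Type*) [CommRing K] (v : V) :
    Γ.tv K v = ∏ e ∈ (Γ.col v).support, Weyl.factor K e (Γ.col v e) := by
  rw [tv, col_support]
  exact Finset.prod_congr rfl fun e _ => Γ.uev_eq_factor K e v

theorem tv_ne_zero (K : Type*) [Field K] (v : V) : Γ.tv K v ≠ 0 := by
  have h (e : E) (a : K) : (MvPolynomial.X e + MvPolynomial.C a : MvPolynomial E K) ≠ 0 := by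
    intro h0
    have := congrArg (MvPolynomial.eval fun _ => 1 - a) h0
    simp at this
  refine Finset.prod_ne_zero_iff.2 fun e _ => mul_ne_zero (Finset.prod_ne_zero_iff.2 fun i _ => ?_)
    (Finset.prod_ne_zero_iff.2 fun i _ => ?_)
  · simpa using h e (i : K)
  · simpa [sub_eq_add_neg] using h e (-((i + 1 : ℕ) : K))

/-- The twisted generalized Weyl datum `(R_E, σ^Γ, t^Γ)` with `σ_v(u_e) = u_e - γ_{ev}`. -/
def datum (K : Type*) [Field K] : TGWDatum K (MvPolynomial E K) V where
  σ v := Weyl.shiftEquiv K (Γ.col v)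
  σ_comm v w := AlgEquiv.ext fun r => by
    change ((Weyl.shift K _).comp (Weyl.shift K _)) r = ((Weyl.shift K _).comp (Weyl.shift K _)) r
    rw [Weyl.shift_comp, Weyl.shift_comp, add_comm]
  t := Γ.tv K
  t_central v := by simp
  t_ne_zero := Γ.tv_ne_zero K

/-- The matrix `μ` with all entries equal to `1`. -/
def μ (V K : Type*) [Field K] : V → V → K := fun _ _ => 1

/-- The twisted generalized Weyl algebra `A(Γ)`. -/
abbrev Alg (K : Type*) [Field K] : Type _ := (Γ.datum K).Alg (μ V K)

/-- The homogeneous component `A(Γ)_g`. -/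
abbrev algPart (K : Type*) [Field K] (g : V →₀ ℤ) : Submodule K (Γ.Alg K) :=
  (Γ.datum K).algPart (μ V K) g

/-- The generator `X_v` of `A(Γ)`. -/
def X (K : Type*) [Field K] (v : V) : Γ.Alg K :=
  (Γ.datum K).toAlg (μ V K) ((Γ.datum K).gen (μ V K) (.X v))

/-- The generator `Y_v` of `A(Γ)`. -/
def Y (K : Type*) [Field K] (v : V) : Γ.Alg K :=
  (Γ.datum K).toAlg (μ V K) ((Γ.datum K).gen (μ V K) (.Y v))

/-- The image `ρ(r)` in `A(Γ)` of `r ∈ R_E`. -/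
def coeff (K : Type*) [Field K] (r : MvPolynomial E K) : Γ.Alg K :=
  (Γ.datum K).toAlg (μ V K) ((Γ.datum K).gen (μ V K) (.coeff r))

/-! ### The representation `φ_Γ` -/

/-- The images in the Weyl algebra of the generators. -/
def φGen (K : Type*) [Field K] : TGWGen (MvPolynomial E K) V → Weyl K E
  | .coeff r => Weyl.coeff K r
  | .X v => Weyl.z K (Γ.col v)
  | .Y v => Weyl.z K (-Γ.col v)

theorem col_mul_col_nonpos {v w : V} (h : v ≠ w) (e : E) : Γ.col v e * Γ.col w e ≤ 0 := by
  change Γ.entry e v * Γ.entry e w ≤ 0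
  have h0 (o : Option (V × ℕ+)) : mult o v = 0 ∨ mult o w = 0 := by
    by_contra hc
    rw [not_or] at hc
    obtain ⟨n, hn⟩ := mult_ne_zero.1 hc.1
    obtain ⟨m, hm⟩ := mult_ne_zero.1 hc.2
    rw [hn] at hm
    simp only [Option.some.injEq, Prod.mk.injEq] at hm
    exact h hm.1
  rcases h0 (Γ.t e) with h1 | h1 <;> rcases h0 (Γ.s e) with h2 | h2 <;> simp [entry, h1, h2] <;>
    positivity

theorem φGen_rel (K : Type*) [Field K] {a b : FreeAlgebra K (TGWGen (MvPolynomial E K) V)}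
    (h : (Γ.datum K).Rel (μ V K) a b) :
    FreeAlgebra.lift K (Γ.φGen K) a = FreeAlgebra.lift K (Γ.φGen K) b := by
  cases h with
  | coeff_add r s => simp [φGen]
  | coeff_mul r s => simp [φGen]
  | coeff_algebraMap k => simp [φGen, ← MvPolynomial.algebraMap_eq]
  | X_coeff v r =>
    simp only [map_mul, FreeAlgebra.lift_ι_apply, φGen]
    exact Weyl.z_mul_coeff K (Γ.col v) r
  | Y_coeff v r =>
    simp only [map_mul, FreeAlgebra.lift_ι_apply, φGen]
    exact Weyl.z_mul_coeff K (-Γ.col v) r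
  | Y_X v =>
    simp only [map_mul, FreeAlgebra.lift_ι_apply, φGen]
    rw [Weyl.z_neg_mul_z]
    exact congrArg _ (Γ.tv_eq K v).symm
  | X_Y v =>
    simp only [map_mul, FreeAlgebra.lift_ι_apply, φGen]
    rw [Weyl.z_mul_z_neg, ← tv_eq]
    rfl
  | X_Y_ne v w h =>
    simp only [map_mul, FreeAlgebra.lift_ι_apply, φGen, μ, one_smul]
    refine Weyl.z_commute_of_mul_nonneg K fun e => ?_
    have := Γ.col_mul_col_nonpos h e
    rw [Finsupp.neg_apply, mul_neg]
    linarith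

/-- The homomorphism from the twisted generalized Weyl construction to the Weyl algebra which
induces `φ_Γ`. -/
def φConstruction (K : Type*) [Field K] : (Γ.datum K).Construction (μ V K) →ₐ[K] Weyl K E :=
  RingQuot.liftAlgHom K ⟨FreeAlgebra.lift K (Γ.φGen K), fun _ _ h => Γ.φGen_rel K h⟩

theorem φConstruction_gen (K : Type*) [Field K] (a : TGWGen (MvPolynomial E K) V) :
    Γ.φConstruction K ((Γ.datum K).gen (μ V K) a) = Γ.φGen K a := by
  simp [φConstruction, TGWDatum.gen]

theorem γ_single (v : V) : Γ.γ (Finsupp.single v 1) = Γ.col v := by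
  simp [γ]

theorem φGen_mem_part (K : Type*) [Field K] (a : TGWGen (MvPolynomial E K) V) :
    Γ.φGen K a ∈ Weyl.part K (Γ.γ (TGWDatum.genDeg a)) := by
  cases a with
  | coeff r => rw [TGWDatum.genDeg, map_zero]; exact Weyl.coeff_mem_part K r
  | X v => rw [TGWDatum.genDeg, γ_single]; exact Weyl.z_mem_part K _
  | Y v => rw [TGWDatum.genDeg, map_neg, γ_single]; exact Weyl.z_mem_part K _

theorem φConstruction_mem_part (K : Type*) [Field K] {g : V →₀ ℤ}
    {a : (Γ.datum K).Construction (μ V K)} (ha : a ∈ (Γ.datum K).constructionPart (μ V K) g) :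
    Γ.φConstruction K a ∈ Weyl.part K (Γ.γ g) := by
  induction ha using Submodule.span_induction with
  | mem a h =>
    obtain ⟨l, rfl, rfl⟩ := h
    induction l with
    | nil => simpa [Weyl.part] using one_mem_gradedPart (Weyl.gen K) Weyl.genDeg
    | cons b l ih =>
      rw [List.map_cons, List.map_cons, List.prod_cons, List.sum_cons, map_mul, map_add,
        φConstruction_gen]
      exact mul_mem_gradedPart _ _ (Γ.φGen_mem_part K b) ih
  | zero => rw [map_zero]; exact zero_mem _
  | add a b _ _ ha hb => rw [map_add]; exact add_mem ha hb
  | smul c a _ ha => rw [map_smul]; exact Submodule.smul_mem _ _ ha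

/-- Each component of the construction contains a monomial which acts injectively. -/
theorem exists_monomial (K : Type*) [Field K] (g : V →₀ ℤ) :
    ∃ b ∈ (Γ.datum K).constructionPart (μ V K) g,
      Function.Injective (Weyl.rep K (Γ.φConstruction K b)) := by
  classical
  have hmul (g h : V →₀ ℤ) : (∃ b ∈ (Γ.datum K).constructionPart (μ V K) g,
      Function.Injective (Weyl.rep K (Γ.φConstruction K b))) →
      (∃ b ∈ (Γ.datum K).constructionPart (μ V K) h,
      Function.Injective (Weyl.rep K (Γ.φConstruction K b))) →
      (∃ b ∈ (Γ.datum K).constructionPart (μ V K) (g + h),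
      Function.Injective (Weyl.rep K (Γ.φConstruction K b))) := by
    rintro ⟨a, ha, ha'⟩ ⟨b, hb, hb'⟩
    refine ⟨a * b, mul_mem_gradedPart _ _ ha hb, ?_⟩
    rw [map_mul, map_mul]
    exact ha'.comp hb'
  have h0 : ∃ b ∈ (Γ.datum K).constructionPart (μ V K) 0,
      Function.Injective (Weyl.rep K (Γ.φConstruction K b)) :=
    ⟨1, one_mem_gradedPart _ _, by rw [map_one, map_one]; exact Function.injective_id⟩
  induction g using Finsupp.induction with
  | zero => exact h0
  | single_add v p g _ hp ih =>
    refine hmul _ _ ?_ ih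
    clear hp
    induction p using Int.induction_on with
    | zero => simpa using h0
    | succ n ih =>
      rw [Finsupp.single_add]
      refine hmul _ _ ih ⟨(Γ.datum K).gen (μ V K) (.X v), Submodule.subset_span
        ⟨[.X v], by simp [TGWDatum.genDeg], by simp⟩, ?_⟩
      rw [φConstruction_gen]
      exact Weyl.rep_z_injective K _
    | pred n ih =>
      rw [sub_eq_add_neg, Finsupp.single_add]
      refine hmul _ _ ih ⟨(Γ.datum K).gen (μ V K) (.Y v), Submodule.subset_span
        ⟨[.Y v], by simp [TGWDatum.genDeg], by simp⟩, ?_⟩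
      rw [φConstruction_gen]
      exact Weyl.rep_z_injective K _

theorem radical_le_ker (K : Type*) [Field K] :
    (Γ.datum K).radical (μ V K) ≤ TwoSidedIdeal.ker (Γ.φConstruction K) := by
  refine sSup_le fun J hJ a ha => ?_
  rw [TwoSidedIdeal.mem_ker]
  have h := hJ.1 a ha
  clear ha
  induction h using Submodule.span_induction with
  | mem b hb =>
    obtain ⟨hbJ, g, hbg⟩ := hb
    obtain ⟨c, hc, hc'⟩ := Γ.exists_monomial K (-g)
    refine Weyl.eq_zero_of_mul_eq_zero K (Γ.φConstruction_mem_part K hbg) hc' ?_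
    rw [← map_mul, hJ.2 (b * c) (J.mul_mem_right _ _ hbJ), map_zero]
    have := mul_mem_gradedPart _ _ hbg hc
    rwa [add_neg_cancel] at this
  | zero => exact map_zero _
  | add b c _ _ hb hc => rw [map_add, hb, hc, add_zero]
  | smul k b _ hb => rw [map_smul, hb, smul_zero]

/-- The canonical representation `φ_Γ : A(Γ) → A_E(K)`. -/
def φ (K : Type*) [Field K] : Γ.Alg K →ₐ[K] Weyl K E :=
  ((Γ.datum K).radical (μ V K)).ringCon.liftₐ (Γ.φConstruction K)
    fun a b h => sub_eq_zero.1 <| by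
      rw [← map_sub]
      exact (TwoSidedIdeal.mem_ker _).1 (Γ.radical_le_ker K (((Γ.datum K).radical (μ V K)).rel_iff a b |>.1 h))

theorem φ_X (K : Type*) [Field K] (v : V) : Γ.φ K (Γ.X K v) = Weyl.z K (Γ.γ (.single v 1)) := by
  rw [γ_single]
  exact Γ.φConstruction_gen K (.X v)

theorem φ_Y (K : Type*) [Field K] (v : V) : Γ.φ K (Γ.Y K v) = Weyl.z K (-Γ.γ (.single v 1)) := by
  rw [γ_single]
  exact Γ.φConstruction_gen K (.Y v)

theorem φ_u (K : Type*) [Field K] (e : E) :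
    Γ.φ K (Γ.coeff K (MvPolynomial.X e)) = Weyl.y K e * Weyl.x K e :=
  (Γ.φConstruction_gen K (.coeff (MvPolynomial.X e))).trans (Weyl.coeff_X K e)

/-- `φ_Γ` is locally surjective if `φ_Γ(A(Γ)_g) = A_E(K)_{γ(g)}` for all `g ∈ ℤV`. -/
def IsLocallySurjective (K : Type*) [Field K] : Prop :=
  ∀ g : V →₀ ℤ, (Γ.algPart K g).map (Γ.φ K).toLinearMap = Weyl.part K (Γ.γ g)

/-! ### Cycles in the underlying undirected graph -/

/-- The proper edge `e` has the two endpoints `a` and `b`, irrespective of its direction. -/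
def Joins (e : E) (a b : V) : Prop :=
  (∃ m n, Γ.s e = some (a, m) ∧ Γ.t e = some (b, n)) ∨
    (∃ m n, Γ.s e = some (b, m) ∧ Γ.t e = some (a, n))

/-- The underlying undirected graph is acyclic: there are no pairwise distinct vertices
`v_0, …, v_n` and pairwise distinct edges `e_0, …, e_n` such that `e_i` joins `v_i` and `v_{i+1}`,
with indices modulo `n + 1`. Two edges between the same two vertices form a cycle. -/
def IsAcyclic : Prop :=
  ¬ ∃ (n : ℕ) (v : Fin (n + 1) → V) (e : Fin (n + 1) → E),
    Function.Injective v ∧ Function.Injective e ∧ ∀ i, Γ.Joins (e i) (v i) (v (i + 1))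

end Multiquiver

end MultiquiverTGW

end

/-! The degree `k` component of the Weyl algebra is free of rank one over `R_E` on `z^k`, and `R_E`
lies in degree zero of `A(Γ)`. Hence `φ(A(Γ)_g) = I_g z^{γ(g)}` for an ideal `I_g` of `R_E`
(`imageIdeal`), and local surjectivity means `I_g = R_E` for all `g`. Everything rests on the
cocycle in `z^k z^l = f(u) z^{k+l}`, which is a product of one-variable polynomials, one per edge.

If the graph is acyclic, suppose that `I_g` lies in a maximal ideal `M`. Each ordering of the
vertices gives an element of `I_g`: the coefficient of the product of the `z^{g_v γ(v)}` in that
order. For an edge between `b` and `v` the factors belonging to the two orders are coprime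
(`isCoprime_zPoly`), so `M` contains at most one of them and forbids at most one order. These
constraints live on a forest, so some ordering of the finite support of `g` meets all of them
(`IsAcyclic.exists_minimal`). Its coefficient avoids the prime `M`, a contradiction. The ordering
depends on `M`.

If there is a cycle, let `g` be the sum of its vertices. A word, read from right to left, is a walk
in `ℤV` from `0` to `g`; the edge `e` sees the integer `c_e + γ(h)_e` at position `h`, with a wall
between `0` and `1`. A walk that crosses the wall and returns has a coefficient vanishing at the end
point (`eval_zPoly_eq_zero`). The starts `c_e` can be chosen so that, without crossing, one end of
each cycle edge cannot become positive before the other (`Joins.exists_start`). Around the cycle no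
vertex can go first, so every word vanishes at the point `c + γ(g)`, and `I_g` is proper. -/

noncomputable section

namespace MultiquiverTGW

namespace Weyl

variable (K : Type*) {E : Type*} [CommRing K]

/-! ### Products of the elements `z^k` -/

/-- The polynomial `f` with `x_e ^ k * y_e ^ m = f(u_e) z_e^{(k - m)}`. -/
def xyPoly : ℕ → ℕ → Polynomial K
  | k + 1, m + 1 => (Polynomial.X - Polynomial.C ((k + 1 : ℕ) : K)) * xyPoly k m
  | 0, _ => 1
  | _ + 1, 0 => 1

/-- The polynomial `f` with `y_e ^ m * x_e ^ k = f(u_e) z_e^{(k - m)}`. -/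
def yxPoly : ℕ → ℕ → Polynomial K
  | m + 1, k + 1 => (Polynomial.X + Polynomial.C (m : K)) * yxPoly m k
  | 0, _ => 1
  | _ + 1, 0 => 1

/-- The polynomial `f` with `z_e^{(p)} z_e^{(q)} = f(u_e) z_e^{(p + q)}`. -/
def zPoly : ℤ → ℤ → Polynomial K
  | .ofNat k, .negSucc m => xyPoly K k (m + 1)
  | .negSucc m, .ofNat k => yxPoly K (m + 1) k
  | .ofNat _, .ofNat _ => 1
  | .negSucc _, .negSucc _ => 1

theorem zgen_natCast (e : E) (n : ℕ) : zgen K e n = x K e ^ n := rfl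

theorem zgen_neg_natCast (e : E) (n : ℕ) : zgen K e (-(n : ℤ)) = y K e ^ n := by
  cases n with
  | zero => exact (pow_zero _).trans (pow_zero _).symm
  | succ n => rfl

theorem x_pow_mul_y_pow (e : E) (k m : ℕ) : x K e ^ k * y K e ^ m =
    coeff K (Polynomial.aeval (MvPolynomial.X e) (xyPoly K k m)) * zgen K e (k - m) := by
  induction k generalizing m with
  | zero => simp [xyPoly, zgen_neg_natCast]
  | succ k ih =>
    cases m with
    | zero =>
      have := zgen_natCast K e (k + 1)
      simp only [Nat.cast_add, Nat.cast_one] at this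
      simp [xyPoly, this]
    | succ m =>
      -- The innermost pair `x y = u - 1` is moved to the left past `x ^ k`, which turns it into `u
      -- - (k + 1)`.
      have h : x K e ^ k * (u K e - 1) = (u K e - ((k + 1 : ℕ) : Weyl K E)) * x K e ^ k := by
        rw [mul_sub, x_pow_u, Nat.cast_succ, ← sub_sub, sub_mul _ 1, one_mul, mul_one]
      rw [pow_succ, pow_succ', mul_assoc, ← mul_assoc (x K e), x_mul_y, ← mul_assoc, h, mul_assoc,
        ih, xyPoly]
      simp [mul_assoc]

theorem y_pow_mul_x_pow (e : E) (m k : ℕ) : y K e ^ m * x K e ^ k =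
    coeff K (Polynomial.aeval (MvPolynomial.X e) (yxPoly K m k)) * zgen K e (k - m) := by
  induction m generalizing k with
  | zero => simp [yxPoly, zgen_natCast]
  | succ m ih =>
    cases k with
    | zero =>
      rw [yxPoly, map_one, map_one, one_mul, pow_zero, mul_one, Nat.cast_zero, zero_sub,
        zgen_neg_natCast]
    | succ k =>
      rw [pow_succ, pow_succ', mul_assoc, ← mul_assoc (y K e), ← u, ← mul_assoc, y_pow_u, mul_assoc,
        ih, yxPoly]
      simp [mul_assoc]

theorem zgen_mul_zgen (e : E) (p q : ℤ) : zgen K e p * zgen K e q =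
    coeff K (Polynomial.aeval (MvPolynomial.X e) (zPoly K p q)) * zgen K e (p + q) := by
  cases p with
  | ofNat k =>
    cases q with
    | ofNat m =>
      rw [show Int.ofNat k + Int.ofNat m = Int.ofNat (k + m) from rfl]
      simp [zgen, zPoly, pow_add]
    | negSucc m =>
      rw [show Int.ofNat k + Int.negSucc m = (k : ℤ) - (m + 1 : ℕ) from rfl]
      exact x_pow_mul_y_pow K e k (m + 1)
  | negSucc m =>
    cases q with
    | ofNat k =>
      rw [show Int.negSucc m + Int.ofNat k = (k : ℤ) - (m + 1 : ℕ) by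
        rw [add_comm]; rfl]
      exact y_pow_mul_x_pow K e (m + 1) k
    | negSucc n =>
      rw [show Int.negSucc m + Int.negSucc n = Int.negSucc (m + n + 1) by
        simp only [Int.negSucc_eq]; push_cast; ring]
      simp only [zgen, zPoly, map_one, one_mul, ← pow_add]
      congr 1
      omega

theorem zPoly_zero_left (q : ℤ) : zPoly K 0 q = 1 := by
  cases q <;> rfl

theorem zPoly_zero_right (p : ℤ) : zPoly K p 0 = 1 := by
  cases p <;> rfl

theorem zPoly_of_mul_nonneg {p q : ℤ} (h : 0 ≤ p * q) : zPoly K p q = 1 := by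
  rcases lt_trichotomy p 0 with hp | rfl | hp
  · rcases lt_trichotomy q 0 with hq | rfl | hq
    · obtain ⟨m, rfl⟩ := Int.eq_negSucc_of_lt_zero hp
      obtain ⟨n, rfl⟩ := Int.eq_negSucc_of_lt_zero hq
      rfl
    · exact zPoly_zero_right K p
    · nlinarith
  · exact zPoly_zero_left K q
  · rcases lt_or_ge q 0 with hq | hq
    · nlinarith
    · lift p to ℕ using hp.le
      lift q to ℕ using hq
      rfl

/-- The products `z_e^{(p)} z_e^{(q)}` and `z_e^{(q)} z_e^{(p)}` have coprime coefficients. -/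
theorem isCoprime_zPoly (F : Type*) [Field F] [CharZero F] (p q : ℤ) :
    IsCoprime (zPoly F p q) (zPoly F q p) := by
  -- Roots of `xyPoly` are positive integers and roots of `yxPoly` are nonpositive ones. Keeping
  -- them apart in the field is the only use of characteristic zero.
  have hlin (i j : ℕ) : IsCoprime (Polynomial.X - Polynomial.C ((i + 1 : ℕ) : F))
      (Polynomial.X + Polynomial.C (j : F)) := by
    rw [show (Polynomial.X + Polynomial.C (j : F)) = Polynomial.X - Polynomial.C (-(j : F)) by simp]
    refine Polynomial.isCoprime_X_sub_C_of_isUnit_sub ?_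
    rw [sub_neg_eq_add, isUnit_iff_ne_zero, ← Nat.cast_add]
    exact Nat.cast_ne_zero.2 (by omega)
  have hright (i m k : ℕ) : IsCoprime (Polynomial.X - Polynomial.C ((i + 1 : ℕ) : F))
      (yxPoly F m k) := by
    induction m generalizing k with
    | zero => simpa [yxPoly] using isCoprime_one_right
    | succ m ih =>
      cases k with
      | zero => simpa [yxPoly] using isCoprime_one_right
      | succ k => exact (hlin i m).mul_right (ih k)
  have hxy (k m m' k' : ℕ) : IsCoprime (xyPoly F k m) (yxPoly F m' k') := by
    induction k generalizing m with
    | zero => simpa [xyPoly] using isCoprime_one_left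
    | succ k ih =>
      cases m with
      | zero => simpa [xyPoly] using isCoprime_one_left
      | succ m => exact (hright k m' k').mul_left (ih m)
  cases p <;> cases q
  · exact isCoprime_one_left
  · exact hxy _ _ _ _
  · exact (hxy _ _ _ _).symm
  · exact isCoprime_one_left

/-- If `d - p - q` and `d` lie on one side of the wall and `d - p` on the other, then the coefficient
of `z_e^{(p)} z_e^{(q)}` vanishes at `d`. -/
theorem eval_zPoly_eq_zero {p q d : ℤ} (h1 : 0 < d ↔ ¬ 0 < d - p) (h2 : 0 < d ↔ 0 < d - p - q) :
    (zPoly K p q).eval (d : K) = 0 := by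
  -- The roots of `xyPoly k m` are the `min k m` integers going down from `k`, which are exactly
  -- those `d > 0` with `d ≤ k < d + m`. Those of `yxPoly m k` go up from `1 - m` in the same way.
  have hxy (k m : ℕ) (h1 : 0 < d) (h2 : d - k ≤ 0) (h3 : 0 < d - k + m) :
      (xyPoly K k m).eval (d : K) = 0 := by
    induction k generalizing m with
    | zero => omega
    | succ k ih =>
      cases m with
      | zero => omega
      | succ m =>
        rw [xyPoly, Polynomial.eval_mul]
        by_cases hd : d = k + 1
        · simp [hd]
        · rw [ih m (by omega) (by omega), mul_zero]
  have hyx (m k : ℕ) (h1 : d ≤ 0) (h2 : 0 < d + m) (h3 : d + m - k ≤ 0) :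
      (yxPoly K m k).eval (d : K) = 0 := by
    induction m generalizing k with
    | zero => omega
    | succ m ih =>
      cases k with
      | zero => omega
      | succ k =>
        rw [yxPoly, Polynomial.eval_mul]
        by_cases hd : d = -m
        · simp [hd]
        · rw [ih k (by omega) (by omega), mul_zero]
  cases p with
  | ofNat k =>
    cases q with
    | ofNat m => simp only [Int.ofNat_eq_natCast] at h1 h2; omega
    | negSucc m =>
      simp only [Int.ofNat_eq_natCast, Int.negSucc_eq] at h1 h2
      exact hxy _ _ (by omega) (by omega) (by push_cast; omega)
  | negSucc m =>
    cases q with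
    | ofNat k =>
      simp only [Int.ofNat_eq_natCast, Int.negSucc_eq] at h1 h2
      exact hyx _ _ (by omega) (by push_cast; omega) (by push_cast; omega)
    | negSucc n => simp only [Int.negSucc_eq] at h1 h2; omega

/-- The polynomial `f` with `z^k z^l = f(u) z^{k + l}`. -/
def cocycle (k l : E →₀ ℤ) : MvPolynomial E K :=
  ∏ e ∈ k.support, Polynomial.aeval (MvPolynomial.X e) (zPoly K (k e) (l e))

theorem shift_aeval_X (c : E → ℤ) (e : E) (h : c e = 0) (f : Polynomial K) :
    shift K c (Polynomial.aeval (MvPolynomial.X e) f) = Polynomial.aeval (MvPolynomial.X e) f := by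
  rw [← Polynomial.aeval_algHom_apply, shift_X, h, Int.cast_zero, sub_zero]

theorem zgen_eq_z (e : E) (p : ℤ) : zgen K e p = z K (Finsupp.single e p) := by
  rw [z_split K _ e, Finsupp.single_eq_same, Finsupp.erase_single, z_zero, mul_one]

/-- Different coordinates commute, so the product can be formed one edge at a time. Edges outside
the support of `k` contribute `zPoly 0 _ = 1`. -/
theorem z_mul_z (k l : E →₀ ℤ) : z K k * z K l = coeff K (cocycle K k l) * z K (k + l) := by
  classical
  induction k using Finsupp.induction with
  | zero => simp [z_zero, cocycle]
  | single_add e p k hk hp ih =>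
    have hke : k e = 0 := Finsupp.notMem_support_iff.1 hk
    have hz : z K (Finsupp.single e p + k) = zgen K e p * z K k := by
      rw [z_split K _ e, Finsupp.erase_add, Finsupp.erase_single, zero_add,
        Finsupp.erase_of_notMem_support hk]
      simp [hke]
    have hs : (Finsupp.single e p + k).support = insert e k.support := by
      rw [Finsupp.support_single_add hk hp, Finset.cons_eq_insert]
    have hc : cocycle K (Finsupp.single e p + k) l =
        cocycle K k l * Polynomial.aeval (MvPolynomial.X e) (zPoly K p (l e)) := by
      rw [cocycle, hs, Finset.prod_insert hk, mul_comm]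
      congr 1
      · refine Finset.prod_congr rfl fun i hi => ?_
        have : i ≠ e := by rintro rfl; exact hk hi
        simp [this.symm]
      · simp [hke]
    -- The variable `u_e` does not occur in the cocycle of `k`, so moving `z_e^{(p)}` past it
    -- changes nothing.
    have hshift : shift K (Finsupp.single e p) (cocycle K k l) = cocycle K k l := by
      rw [cocycle, map_prod]
      refine Finset.prod_congr rfl fun i hi => shift_aeval_X K _ _ ?_ _
      rw [Finsupp.single_eq_of_ne]
      rintro rfl
      exact hk hi
    have he : ((Finsupp.single e p + k) + l).erase e = (k + l).erase e := by
      simp [Finsupp.erase_add]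
    rw [hz, mul_assoc, ih, zgen_eq_z, ← mul_assoc, z_mul_coeff, hshift, ← zgen_eq_z, hc, map_mul,
      mul_assoc, mul_assoc]
    congr 1
    rw [z_split K (k + l) e, z_split K (Finsupp.single e p + k + l) e, he, ← mul_assoc,
      zgen_mul_zgen]
    simp [hke, mul_assoc]

theorem z_mul_z_of_mul_nonneg {k l : E →₀ ℤ} (h : ∀ e, 0 ≤ k e * l e) :
    z K k * z K l = z K (k + l) := by
  rw [z_mul_z, cocycle, Finset.prod_eq_one, map_one, one_mul]
  intro e _
  rw [zPoly_of_mul_nonneg K (h e), map_one]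

theorem z_pow (k : E →₀ ℤ) (n : ℕ) : z K k ^ n = z K ((n : ℤ) • k) := by
  induction n with
  | zero => simp [z_zero]
  | succ n ih =>
    rw [pow_succ, ih, z_mul_z_of_mul_nonneg]
    · rw [Nat.cast_succ, add_smul, one_smul]
    · intro e
      rw [Finsupp.smul_apply, smul_eq_mul, mul_assoc]
      exact mul_nonneg (Int.natCast_nonneg n) (mul_self_nonneg _)

/-- This is the freeness of the graded components over `R_E`. In the polynomial representation,
apply both sides to `1`: `z^k` acts injectively, so `z^k · 1` is a nonzero polynomial and cancels.
-/
theorem coeff_mul_z_injective [IsDomain K] (k : E →₀ ℤ) :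
    Function.Injective fun q => coeff K q * z K k := by
  intro p q h
  have h' := congrArg (fun a => rep K a 1) h
  simp only [map_mul, Module.End.mul_apply, rep_coeff] at h'
  refine mul_right_cancel₀ (fun h0 => one_ne_zero (α := MvPolynomial E K) ?_) h'
  exact rep_z_injective K k (h0.trans (map_zero _).symm)

end Weyl

namespace Multiquiver

variable {V E : Type*} (Γ : Multiquiver V E)

/-! ### Values of the incidence matrix -/

/-- The contribution of an edge end to the values of the incidence matrix. -/
def endValue (h : V →₀ ℤ) : Option (V × ℕ+) → ℤ
  | some (v, n) => (n : ℕ) * h v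
  | none => 0

theorem γ_apply (h : V →₀ ℤ) (e : E) : Γ.γ h e = endValue h (Γ.t e) - endValue h (Γ.s e) := by
  have hadd (h h' : V →₀ ℤ) (o : Option (V × ℕ+)) :
      endValue (h + h') o = endValue h o + endValue h' o := by
    rcases o with _ | ⟨v, n⟩ <;> simp [endValue, mul_add]
  have hsingle (v : V) (p : ℤ) (o : Option (V × ℕ+)) :
      endValue (Finsupp.single v p) o = p * mult o v := by
    rcases o with _ | ⟨w, n⟩
    · simp [endValue, mult]
    · by_cases hw : w = v
      · simp [endValue, mult, hw, mul_comm]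
      · simp [endValue, mult, hw, Finsupp.single_eq_of_ne hw]
  induction h using Finsupp.induction_linear with
  | zero => rcases Γ.t e with _ | ⟨v, n⟩ <;> rcases Γ.s e with _ | ⟨w, m⟩ <;> simp [endValue]
  | add h h' ih ih' =>
    rw [map_add, Finsupp.add_apply, ih, ih', hadd, hadd]
    ring
  | single v p =>
    rw [hsingle, hsingle, ← mul_sub, γ, Finsupp.linearCombination_single]
    rfl

theorem Joins.symm {Γ : Multiquiver V E} {e : E} {a b : V} (h : Γ.Joins e a b) : Γ.Joins e b a :=
  Or.symm h

theorem Joins.ne {Γ : Multiquiver V E} {e : E} {a b : V} (h : Γ.Joins e a b) : a ≠ b := by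
  rcases h with ⟨m, n, hs, ht⟩ | ⟨m, n, hs, ht⟩
  · exact Γ.no_loops e a b m n hs ht
  · exact (Γ.no_loops e b a m n hs ht).symm

theorem Joins.γ_apply {Γ : Multiquiver V E} {e : E} {a b : V} (hab : Γ.Joins e a b)
    (h : V →₀ ℤ) : Γ.γ h e = Γ.entry e a * h a + Γ.entry e b * h b := by
  have hne := hab.ne
  rcases hab with ⟨m, n, hs, ht⟩ | ⟨m, n, hs, ht⟩ <;>
    rw [Multiquiver.γ_apply, hs, ht] <;> simp [entry, hs, ht, endValue, mult, hne, hne.symm] <;>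
      ring

/-- An edge incident to `v` is a half-edge or joins `v` to another vertex. -/
theorem γ_apply_or_joins {e : E} {v : V} (he : Γ.entry e v ≠ 0) :
    (∀ h : V →₀ ℤ, Γ.γ h e = Γ.entry e v * h v) ∨ ∃ b, Γ.Joins e b v := by
  have hm : mult (Γ.t e) v ≠ 0 ∨ mult (Γ.s e) v ≠ 0 := by
    by_contra hc
    simp only [not_or, not_not] at hc
    exact he (by simp [entry, hc.1, hc.2])
  rcases hm with hm | hm
  · obtain ⟨n, hn⟩ := mult_ne_zero.1 hm
    rcases hs : Γ.s e with _ | ⟨b, m⟩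
    · left
      intro h
      simp [γ_apply, entry, hs, hn, endValue, mult]
    · exact .inr ⟨b, .inl ⟨m, n, hs, hn⟩⟩
  · obtain ⟨n, hn⟩ := mult_ne_zero.1 hm
    rcases ht : Γ.t e with _ | ⟨b, m⟩
    · left
      intro h
      simp [γ_apply, entry, ht, hn, endValue, mult]
    · exact .inr ⟨b, .inr ⟨n, m, hn, ht⟩⟩

/-! ### Local surjectivity on acyclic multiquivers -/

section Acyclic

variable {Γ}

/-- A relation on the vertices which is witnessed by edges, each of them in at most one direction,
has minimal elements in finite sets if the multiquiver is acyclic. -/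
theorem IsAcyclic.exists_minimal (hΓ : Γ.IsAcyclic) (P : E → V → V → Prop)
    (hP : ∀ e a b, P e a b → Γ.Joins e a b)
    (hP' : ∀ e a b, P e a b → ¬ P e b a) {S : Finset V} (hS : S.Nonempty) :
    ∃ v ∈ S, ∀ b ∈ S, ∀ e, ¬ P e b v := by
  by_contra! hc
  choose! p hpS e hpe using hc
  obtain ⟨v₀, hv₀⟩ := hS
  -- If no element were minimal, a choice of predecessors would be a self-map of a finite set. The
  -- orbit of a periodic point is then a cycle of the graph.
  let f : S → S := fun v => ⟨p v, hpS v v.2⟩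
  have hper : ∃ x : S, x ∈ Function.periodicPts f := by
    obtain ⟨m, n, hmn, heq⟩ := Finite.exists_ne_map_eq_of_infinite fun n => f^[n] ⟨v₀, hv₀⟩
    wlog hlt : m < n generalizing m n
    · exact this n m hmn.symm heq.symm (by omega)
    refine ⟨f^[m] ⟨v₀, hv₀⟩, Function.mk_mem_periodicPts (n := n - m) (by omega) ?_⟩
    change f^[n - m] (f^[m] _) = _
    rw [← Function.iterate_add_apply, Nat.sub_add_cancel hlt.le]
    exact heq.symm
  obtain ⟨x, hx⟩ := hper
  obtain ⟨n, hn⟩ := Nat.exists_eq_succ_of_ne_zero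
    (Function.minimalPeriod_pos_of_mem_periodicPts hx).ne'
  have hinj : Function.Injective fun i : Fin (n + 1) => (f^[i] x : V) := by
    intro i j hij
    have := Function.iterate_injOn_Iio_minimalPeriod (f := f) (x := x)
      (Set.mem_Iio.2 (hn ▸ i.2)) (Set.mem_Iio.2 (hn ▸ j.2)) (Subtype.ext hij)
    exact Fin.ext this
  -- The minimal period is `n + 1`, so addition in `Fin (n + 1)` agrees with iteration, including
  -- the wrap-around.
  have hsucc (i : Fin (n + 1)) : (f^[(i + 1 : Fin (n + 1))] x : V) = p (f^[i] x) := by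
    have h1 : ((i + 1 : Fin (n + 1)) : ℕ) = (i + 1) % (n + 1) := by
      rw [Fin.val_add, Fin.val_one']
      simp
    have h2 := Function.iterate_mod_minimalPeriod_eq (f := f) (x := x) (n := i + 1)
    rw [hn] at h2
    rw [h1, h2, Function.iterate_succ_apply']
  have hstep (i : Fin (n + 1)) :
      P (e (f^[i] x) (f^[i] x).2) (f^[(i + 1 : Fin (n + 1))] x) (f^[i] x) := by
    rw [hsucc]
    exact hpe _ (f^[i] x).2
  refine hΓ ⟨n, fun i => f^[i] x, fun i => e (f^[i] x) (f^[i] x).2, hinj, ?_,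
    fun i => (hP _ _ _ (hstep i)).symm⟩
  intro i j hij
  have hi := hstep i
  have hj := hstep j
  simp only at hij
  rw [hij] at hi
  -- An edge has only two ends. A repeated edge would thus either have the same lower vertex,
  -- forcing equal indices, or be used in both directions, which `hP'` excludes.
  have ends {e : E} {a b c d : V} (h : Γ.Joins e a b) (h' : Γ.Joins e c d) :
      b = d ∨ (a = d ∧ b = c) := by
    rcases h with ⟨m, n, h1, h2⟩ | ⟨m, n, h1, h2⟩ <;>
      rcases h' with ⟨m', n', h1', h2'⟩ | ⟨m', n', h1', h2'⟩ <;>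
      rw [h1] at h1' <;> rw [h2] at h2' <;>
      simp only [Option.some.injEq, Prod.mk.injEq] at h1' h2' <;> tauto
  rcases ends (hP _ _ _ hi) (hP _ _ _ hj) with h | ⟨h1, h2⟩
  · exact hinj h
  · rw [h1, h2] at hi
    exact absurd hi (hP' _ _ _ hj)

end Acyclic

variable (K : Type*) [Field K]

/-! ### The ideal of coefficients of a component of the image -/

theorem map_algPart (g : V →₀ ℤ) : (Γ.algPart K g).map (Γ.φ K).toLinearMap =
    ((Γ.datum K).constructionPart (μ V K) g).map (Γ.φConstruction K).toLinearMap := by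
  rw [algPart, TGWDatum.algPart, ← Submodule.map_comp]
  rfl

theorem map_algPart_le (g : V →₀ ℤ) :
    (Γ.algPart K g).map (Γ.φ K).toLinearMap ≤ Weyl.part K (Γ.γ g) := by
  rw [map_algPart]
  rintro _ ⟨a, ha, rfl⟩
  exact Γ.φConstruction_mem_part K ha

/-- The ideal of all `q ∈ R_E` with `q z^{γ(g)} ∈ φ_Γ(A(Γ)_g)`. -/
def imageIdeal (g : V →₀ ℤ) : Ideal (MvPolynomial E K) where
  carrier := {q | Weyl.coeff K q * Weyl.z K (Γ.γ g) ∈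
    ((Γ.datum K).constructionPart (μ V K) g).map (Γ.φConstruction K).toLinearMap}
  zero_mem' := by
    rw [Set.mem_ofPred_eq, map_zero, zero_mul]
    exact zero_mem _
  add_mem' {p q} hp hq := by
    simp only [Set.mem_ofPred_eq, map_add, add_mul] at hp hq ⊢
    exact add_mem hp hq
  smul_mem' r q hq := by
    obtain ⟨a, ha, h⟩ := hq
    refine ⟨(Γ.datum K).gen (μ V K) (.coeff r) * a, ?_, ?_⟩
    · have : (Γ.datum K).gen (μ V K) (.coeff r) ∈ (Γ.datum K).constructionPart (μ V K) 0 :=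
        Submodule.subset_span ⟨[.coeff r], by simp [TGWDatum.genDeg], by simp⟩
      have := mul_mem_gradedPart _ _ this ha
      rwa [zero_add] at this
    · simp only [AlgHom.toLinearMap_apply] at h ⊢
      rw [map_mul, h, φConstruction_gen, φGen, smul_eq_mul, map_mul, mul_assoc]

theorem mem_imageIdeal {g : V →₀ ℤ} {q : MvPolynomial E K} : q ∈ Γ.imageIdeal K g ↔
    ∃ a ∈ (Γ.datum K).constructionPart (μ V K) g,
      Γ.φConstruction K a = Weyl.coeff K q * Weyl.z K (Γ.γ g) :=
  Iff.rfl

theorem one_mem_imageIdeal_zero : (1 : MvPolynomial E K) ∈ Γ.imageIdeal K 0 := by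
  rw [mem_imageIdeal]
  refine ⟨1, one_mem_gradedPart _ _, ?_⟩
  rw [map_one, map_one, map_zero, Weyl.z_zero, one_mul]

/-- The Weyl component is `R_E z^{γ(g)}`, so the image fills it as soon as it contains `z^{γ(g)}`,
that is, as soon as `1` lies in the ideal. -/
theorem map_algPart_eq_part_iff (g : V →₀ ℤ) :
    (Γ.algPart K g).map (Γ.φ K).toLinearMap = Weyl.part K (Γ.γ g) ↔ Γ.imageIdeal K g = ⊤ := by
  rw [Ideal.eq_top_iff_one, mem_imageIdeal, map_one, one_mul]
  constructor
  · intro h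
    have hz := Weyl.z_mem_part K (Γ.γ g)
    rw [← h, map_algPart] at hz
    exact hz
  · intro h
    refine le_antisymm (Γ.map_algPart_le K g) fun a ha => ?_
    obtain ⟨q, rfl⟩ := Weyl.exists_eq_of_mem_part K ha
    rw [map_algPart]
    have h1 : (1 : MvPolynomial E K) ∈ Γ.imageIdeal K g := by
      rw [mem_imageIdeal, map_one, one_mul]
      exact h
    have := Ideal.mul_mem_left _ q h1
    rw [mul_one] at this
    exact this

/-- Powers of a single `X_v` or `Y_v` produce no coefficient, since no coordinate changes sign.
These are the blocks from which ordered products are built. -/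
theorem exists_map_eq_z_smul (v : V) (p : ℤ) :
    ∃ a ∈ (Γ.datum K).constructionPart (μ V K) (Finsupp.single v p),
      Γ.φConstruction K a = Weyl.z K (Γ.γ (Finsupp.single v p)) := by
  have hγ : Γ.γ (Finsupp.single v p) = p • Γ.col v := by
    rw [γ, Finsupp.linearCombination_single]
  rw [hγ]
  rcases Int.eq_nat_or_neg p with ⟨n, rfl | rfl⟩
  · refine ⟨(Γ.datum K).gen (μ V K) (.X v) ^ n, Submodule.subset_span
      ⟨List.replicate n (.X v), by simp [TGWDatum.genDeg], by simp⟩, ?_⟩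
    rw [map_pow, φConstruction_gen, φGen, Weyl.z_pow]
  · refine ⟨(Γ.datum K).gen (μ V K) (.Y v) ^ n, Submodule.subset_span
      ⟨List.replicate n (.Y v), by simp [TGWDatum.genDeg], by simp⟩, ?_⟩
    rw [map_pow, φConstruction_gen, φGen, Weyl.z_pow, smul_neg, neg_smul]

variable {Γ} in
theorem IsAcyclic.imageIdeal_eq_top [CharZero K] (hΓ : Γ.IsAcyclic) (g : V →₀ ℤ) :
    Γ.imageIdeal K g = ⊤ := by
  classical
  by_contra hne
  obtain ⟨M, hM, hgM⟩ := Ideal.exists_le_maximal _ hne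
  have hprime := hM.isPrime
  have hone : (1 : MvPolynomial E K) ∉ M := fun h => hprime.ne_top ((Ideal.eq_top_iff_one M).2 h)
  -- The factor contributed by the edge `e` when the power for `b` stands to the left of the power
  -- for `v`. If it lies in `M`, that order is forbidden.
  let w (e : E) (b v : V) : MvPolynomial E K := Polynomial.aeval (MvPolynomial.X e)
    (Weyl.zPoly K (Γ.entry e b * g b) (Γ.entry e v * g v))
  have hw (e : E) (b v : V) (h : w e b v ∈ M) : w e v b ∉ M := by
    intro h'
    obtain ⟨r, s, hrs⟩ := (Weyl.isCoprime_zPoly K (Γ.entry e b * g b) (Γ.entry e v * g v)).map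
      (Polynomial.aeval (R := K) (MvPolynomial.X (R := K) e)).toRingHom
    refine hone ?_
    rw [← hrs]
    exact add_mem (M.mul_mem_left _ h) (M.mul_mem_left _ h')
  have key (S : Finset V) : ∃ q ∉ M, q ∈ Γ.imageIdeal K (g.filter (· ∈ S)) := by
    induction S using Finset.strongInduction with
    | H S ih =>
      rcases S.eq_empty_or_nonempty with rfl | hS
      · refine ⟨1, hone, ?_⟩
        have h0 : g.filter (· ∈ (∅ : Finset V)) = 0 := by ext; simp
        rw [h0]
        exact Γ.one_mem_imageIdeal_zero K
      -- No other vertex of `S` is forbidden to stand to the left of this `v`, so the block of `v`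
      -- is put at the right end, behind a good product for the remaining vertices.
      · obtain ⟨v, hvS, hv⟩ := hΓ.exists_minimal (fun e a b => Γ.Joins e a b ∧ w e a b ∈ M)
          (fun _ _ _ h => h.1) (fun e a b h h' => hw e a b h.2 h'.2) hS
        obtain ⟨q, hqM, a, ha, haq⟩ := ih (S.erase v) (Finset.erase_ssubset hvS)
        obtain ⟨b, hb, hbz⟩ := Γ.exists_map_eq_z_smul K v (g v)
        set h := g.filter (· ∈ S.erase v) with hh
        have hsum : g.filter (· ∈ S) = h + Finsupp.single v (g v) := by
          ext i
          by_cases hi : i = v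
          · subst hi; simp [hh, hvS]
          · simp [hh, Finsupp.filter_apply, hi, Finsupp.single_eq_of_ne hi]
        refine ⟨q * Weyl.cocycle K (Γ.γ h) (Γ.γ (Finsupp.single v (g v))), ?_, ?_⟩
        -- As `M` is prime, a single edge `e` would contribute a factor in `M`. That factor is `1`
        -- unless `e` joins `v` to some `c ∈ S`, and then it is `w e c v`, excluded by the choice of
        -- `v`.
        · refine fun hmem => (hprime.mem_or_mem hmem).elim hqM fun hmem => ?_
          obtain ⟨e, -, he⟩ := (hprime.prod_mem_iff).1 hmem
          have hγv : Γ.γ (Finsupp.single v (g v)) e = Γ.entry e v * g v := by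
            rw [γ, Finsupp.linearCombination_single, Finsupp.smul_apply, smul_eq_mul, mul_comm]
            rfl
          have hhv : h v = 0 := by simp [hh]
          rw [hγv] at he
          by_cases hev : Γ.entry e v = 0
          · rw [hev, zero_mul, Weyl.zPoly_zero_right, map_one] at he
            exact hone he
          rcases Γ.γ_apply_or_joins hev with hγ | ⟨c, hc⟩
          · rw [hγ, hhv, mul_zero, Weyl.zPoly_zero_left, map_one] at he
            exact hone he
          · rw [hc.γ_apply, hhv, mul_zero, add_zero] at he
            by_cases hcS : c ∈ S
            · have : h c = g c := by simp [hh, hcS, hc.ne]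
              rw [this] at he
              exact hv c hcS e ⟨hc, he⟩
            · have : h c = 0 := by simp [hh, hcS]
              rw [this, mul_zero, Weyl.zPoly_zero_left, map_one] at he
              exact hone he
        · rw [mem_imageIdeal, hsum]
          refine ⟨a * b, mul_mem_gradedPart _ _ ha hb, ?_⟩
          rw [AlgHom.toLinearMap_apply] at haq
          rw [map_mul, haq, hbz, mul_assoc, Weyl.z_mul_z, ← mul_assoc, ← map_mul, ← map_add]
  obtain ⟨q, hq, hqg⟩ := key g.support
  have hg : g.filter (· ∈ g.support) = g := by
    rw [Finsupp.filter_eq_self_iff]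
    simp
  rw [hg] at hqg
  exact hq (hgM hqg)

/-! ### Failure of local surjectivity in the presence of a cycle -/

variable {Γ} in
/-- For each edge between `a` and `b` there is a start such that one cannot go up at `b` from `0`
to `1` before doing so at `a` without leaving the side of the wall. -/
theorem Joins.exists_start {e : E} {a b : V} (hab : Γ.Joins e a b) : ∃ c : ℤ,
    (∀ h : V →₀ ℤ, (0 < c + Γ.γ h e ↔ 0 < c) → 0 < h b → 0 < h a) ∧
    ∀ h : V →₀ ℤ, h a = 1 → h b = 1 → (0 < c + Γ.γ h e ↔ 0 < c) := by
  rcases hab with ⟨m, n, hs, ht⟩ | ⟨m, n, hs, ht⟩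
  · have hm : (0 : ℤ) < (m : ℕ) := by exact_mod_cast m.pos
    have hn : (0 : ℤ) < (n : ℕ) := by exact_mod_cast n.pos
    -- Here `γ(h)_e = n h_b - m h_a` and the start is on the side `≤ 0`. Raising `b` to `1` alone
    -- lands at `1`, just across the wall, while raising both ends lands at `1 - m ≤ 0`.
    refine ⟨1 - (n : ℕ), fun h hside hb => ?_, fun h ha hb => ?_⟩
    · rw [Γ.γ_apply, hs, ht] at hside
      simp only [endValue] at hside
      have h1 : ¬ (0 : ℤ) < 1 - (n : ℕ) := by omega
      simp only [h1, iff_false, not_lt] at hside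
      by_contra hc
      nlinarith
    · rw [Γ.γ_apply, hs, ht]
      simp only [endValue, ha, hb]
      omega
  · have hm : (0 : ℤ) < (m : ℕ) := by exact_mod_cast m.pos
    have hn : (0 : ℤ) < (n : ℕ) := by exact_mod_cast n.pos
    -- Now `γ(h)_e = n h_a - m h_b` and the start is on the positive side. Raising `b` alone lands
    -- at `0`, raising both ends lands at `n > 0`.
    refine ⟨(m : ℕ), fun h hside hb => ?_, fun h ha hb => ?_⟩
    · rw [Γ.γ_apply, hs, ht] at hside
      simp only [endValue, hm, iff_true] at hside
      by_contra hc
      nlinarith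
    · rw [Γ.γ_apply, hs, ht]
      simp only [endValue, ha, hb]
      omega

/-! ### Walks and the values of their coefficients at the end point -/

theorem eval_shift (c d : E → ℤ) (q : MvPolynomial E K) :
    MvPolynomial.eval (fun e => ((c e : ℤ) : K)) (Weyl.shift K d q) =
      MvPolynomial.eval (fun e => ((c e - d e : ℤ) : K)) q := by
  induction q using MvPolynomial.induction_on with
  | C a => rw [← MvPolynomial.algebraMap_eq, AlgHom.commutes, MvPolynomial.algebraMap_eq]; simp
  | add p q hp hq => simp only [map_add, hp, hq]
  | mul_X p e hp => simp [map_mul, hp]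

theorem eval_aeval_X (c : E → K) (e : E) (f : Polynomial K) :
    MvPolynomial.eval c (Polynomial.aeval (MvPolynomial.X e) f) = f.eval (c e) := by
  rw [← MvPolynomial.coe_aeval_eq_eval, RingHom.coe_coe, ← Polynomial.aeval_algHom_apply]
  simp [Polynomial.aeval_def, Polynomial.eval₂_eq_eval_map]

section Walk

variable {ι : Type*} {a b : ι → V} {e : ι → E} {c : E → ℤ}

/-- A step `δ` of a walk which leads to a position `δ + h` where all edges `e i` are on the side on
which they were at the start, and which is positive somewhere. -/
theorem eval_shift_mul_cocycle_eq_zero (hab : ∀ i, a i ≠ b i) (hba : ∀ i, ∃ j, a i = b j)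
    (hc : ∀ i (h : V →₀ ℤ), (0 < c (e i) + Γ.γ h (e i) ↔ 0 < c (e i)) → 0 < h (b i) → 0 < h (a i))
    {δ h : V →₀ ℤ} (hδ : ∀ x y, 0 < δ x → 0 < δ y → x = y) {q : MvPolynomial E K}
    (hq : (∀ i, (0 < c (e i) + Γ.γ h (e i) ↔ 0 < c (e i))) → (∃ i, 0 < h (b i)) →
      MvPolynomial.eval (fun f => ((c f + Γ.γ h f : ℤ) : K)) q = 0)
    (hside : ∀ i, (0 < c (e i) + Γ.γ (δ + h) (e i) ↔ 0 < c (e i)))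
    (hpos : ∃ i, 0 < (δ + h) (b i)) :
    MvPolynomial.eval (fun f => ((c f + Γ.γ (δ + h) f : ℤ) : K))
      (Weyl.shift K (Γ.γ δ) q * Weyl.cocycle K (Γ.γ δ) (Γ.γ h)) = 0 := by
  rw [map_mul, eval_shift K (fun f => c f + Γ.γ (δ + h) f) (Γ.γ δ)]
  have hγ (f : E) : Γ.γ (δ + h) f = Γ.γ δ f + Γ.γ h f := by rw [map_add, Finsupp.add_apply]
  by_cases hs : ∀ i, (0 < c (e i) + Γ.γ h (e i) ↔ 0 < c (e i))
  · by_cases hp : ∃ i, 0 < h (b i)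
    · have hd : (fun f => ((c f + Γ.γ (δ + h) f - Γ.γ δ f : ℤ) : K)) =
          fun f => ((c f + Γ.γ h f : ℤ) : K) := by
        -- The shift by `γ(δ)` moves the evaluation point back to the previous position, where `q`
        -- vanishes by hypothesis.
        funext f
        rw [hγ]
        congr 1
        ring
      rw [hd, hq hs hp, zero_mul]
    -- Previously no `b i` was positive, and now some `b i` is. Staying on the side forces `a i`,
    -- itself some `b j`, to be positive too, so the step `δ` would raise two distinct vertices at
    -- once.
    · exfalso
      simp only [not_exists, not_lt] at hp
      obtain ⟨i, hi⟩ := hpos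
      have hi' := hc i _ (hside i) hi
      obtain ⟨j, hj⟩ := hba i
      have hpj := hp j
      rw [← hj] at hpj
      rw [Finsupp.add_apply] at hi hi'
      exact hab i (hδ _ _ (by linarith) (by linarith [hp i]))
  · simp only [not_forall] at hs
    obtain ⟨i, hi⟩ := hs
    have hsi := hside i
    rw [hγ] at hsi
    -- The previous position was across the wall of `e i` and this step returns, so the factor of
    -- the cocycle at `e i` vanishes.
    rw [Weyl.cocycle, map_prod, Finset.prod_eq_zero (i := e i), mul_zero]
    · rw [Finsupp.mem_support_iff]
      intro h0
      rw [h0, zero_add] at hsi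
      exact hi hsi
    · rw [eval_aeval_X, hγ]
      apply Weyl.eval_zPoly_eq_zero
      · rw [show c (e i) + (Γ.γ δ (e i) + Γ.γ h (e i)) - Γ.γ δ (e i) = c (e i) + Γ.γ h (e i) by ring]
        tauto
      · rw [show c (e i) + (Γ.γ δ (e i) + Γ.γ h (e i)) - Γ.γ δ (e i) - Γ.γ h (e i) = c (e i) by ring]
        exact hsi

/-- A word whose walk in `ℤV` ends at a position which is positive somewhere, with all edges `e i` on
the side on which they were at the start, acts by a coefficient which vanishes at the end. -/
theorem exists_eq_of_word (hab : ∀ i, a i ≠ b i) (hba : ∀ i, ∃ j, a i = b j)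
    (hc : ∀ i (h : V →₀ ℤ), (0 < c (e i) + Γ.γ h (e i) ↔ 0 < c (e i)) → 0 < h (b i) → 0 < h (a i))
    (l : List (TGWGen (MvPolynomial E K) V)) :
    ∃ q, Γ.φConstruction K (l.map ((Γ.datum K).gen (μ V K))).prod =
        Weyl.coeff K q * Weyl.z K (Γ.γ (l.map TGWDatum.genDeg).sum) ∧
      ((∀ i, (0 < c (e i) + Γ.γ (l.map TGWDatum.genDeg).sum (e i) ↔ 0 < c (e i))) →
        (∃ i, 0 < (l.map TGWDatum.genDeg).sum (b i)) →
        MvPolynomial.eval (fun f => ((c f + Γ.γ (l.map TGWDatum.genDeg).sum f : ℤ) : K)) q = 0) := by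
  induction l with
  -- The empty walk ends at `0`, which is nowhere positive, so the vanishing claim is vacuous.
  | nil => exact ⟨1, by simp [Weyl.z_zero], by simp⟩
  | cons w l ih =>
    obtain ⟨q, hq, hq0⟩ := ih
    rw [List.map_cons, List.map_cons, List.prod_cons, List.sum_cons, map_mul, hq,
      φConstruction_gen]
    have hmul (δ h : V →₀ ℤ) : Weyl.z K (Γ.γ δ) * (Weyl.coeff K q * Weyl.z K (Γ.γ h)) =
        Weyl.coeff K (Weyl.shift K (Γ.γ δ) q * Weyl.cocycle K (Γ.γ δ) (Γ.γ h)) *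
          Weyl.z K (Γ.γ (δ + h)) := by
      rw [← mul_assoc, Weyl.z_mul_coeff, mul_assoc, Weyl.z_mul_z, map_mul, map_add, mul_assoc]
    cases w with
    | coeff r =>
      refine ⟨r * q, ?_, ?_⟩
      · rw [φGen, TGWDatum.genDeg, zero_add, map_mul, mul_assoc]
      · rw [TGWDatum.genDeg, zero_add]
        intro h1 h2
        rw [map_mul, hq0 h1 h2, mul_zero]
    | X v =>
      rw [φGen, ← γ_single]
      refine ⟨_, hmul _ _, Γ.eval_shift_mul_cocycle_eq_zero K hab hba hc ?_ hq0⟩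
      have hpos (x : V) (hx : 0 < Finsupp.single v (1 : ℤ) x) : x = v := by
        by_contra hne
        rw [Finsupp.single_eq_of_ne hne] at hx
        exact lt_irrefl _ hx
      exact fun x y hx hy => (hpos x hx).trans (hpos y hy).symm
    | Y v =>
      rw [φGen, ← γ_single, ← map_neg]
      refine ⟨_, hmul _ _, Γ.eval_shift_mul_cocycle_eq_zero K hab hba hc ?_ hq0⟩
      -- A step by `Y_v` raises no vertex at all.
      intro x y hx _
      rw [TGWDatum.genDeg, Finsupp.neg_apply] at hx
      have : 0 ≤ Finsupp.single v (1 : ℤ) x := Finsupp.single_nonneg.2 zero_le_one x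
      omega

end Walk

theorem IsLocallySurjective.isAcyclic {Γ : Multiquiver V E} (hsurj : Γ.IsLocallySurjective K) :
    Γ.IsAcyclic := by
  classical
  rintro ⟨n, v, e, hv, he, hjoin⟩
  choose c hc hc' using fun i => (hjoin i).exists_start
  -- Starts matter only on the cycle; the value `0` at the other edges is arbitrary.
  let d : E → ℤ := Function.extend e c 0
  have hd (i) : d (e i) = c i := he.extend_apply _ _ _
  let g : V →₀ ℤ := ∑ i, Finsupp.single (v i) 1
  have hg (i) : g (v i) = 1 := by
    simp only [g, Finsupp.finsetSum_apply]
    rw [Finset.sum_eq_single i]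
    · simp
    · intro j _ hj
      exact Finsupp.single_eq_of_ne fun h => hj (hv h).symm
    · simp
  let p : E → K := fun f => ((d f + Γ.γ g f : ℤ) : K)
  -- Vanishing at `p` passes from words to their span, so the whole component of degree `g` has
  -- coefficients in the kernel of evaluation at `p`.
  have himage (w) (hw : w ∈ (Γ.datum K).constructionPart (μ V K) g) :
      ∃ q, Γ.φConstruction K w = Weyl.coeff K q * Weyl.z K (Γ.γ g) ∧
        MvPolynomial.eval p q = 0 := by
    induction hw using Submodule.span_induction with
    | mem w hw =>
      obtain ⟨l, hl, rfl⟩ := hw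
      obtain ⟨q, hq, hq0⟩ := Γ.exists_eq_of_word K (a := v) (b := fun i => v (i + 1)) (e := e)
        (c := d) (fun i => (hjoin i).ne) (fun i => ⟨i - 1, by simp⟩)
        (fun i => by rw [hd]; exact hc i) l
      rw [hl] at hq hq0
      exact ⟨q, hq, hq0 (fun i => by rw [hd]; exact hc' i g (hg _) (hg _))
        ⟨0, by rw [hg]; exact zero_lt_one⟩⟩
    | zero => exact ⟨0, by simp, by simp⟩
    | add w w' _ _ hw hw' =>
      obtain ⟨q, hq, hq0⟩ := hw
      obtain ⟨q', hq', hq0'⟩ := hw'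
      exact ⟨q + q', by rw [map_add, hq, hq', map_add, add_mul], by rw [map_add, hq0, hq0', add_zero]⟩
    | smul k w _ hw =>
      obtain ⟨q, hq, hq0⟩ := hw
      exact ⟨k • q, by rw [map_smul, hq, map_smul, smul_mul_assoc],
        by rw [MvPolynomial.smul_eval, hq0, mul_zero]⟩
  have htop := (Ideal.eq_top_iff_one _).1 ((Γ.map_algPart_eq_part_iff K g).1 (hsurj g))
  obtain ⟨w, hw, hw1⟩ := (Γ.mem_imageIdeal K).1 htop
  obtain ⟨q, hq, hq0⟩ := himage w hw
  -- By freeness the coefficient is unique, so `1` itself would vanish at `p`.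
  have hq1 : (1 : MvPolynomial E K) = q := Weyl.coeff_mul_z_injective K (Γ.γ g) (hw1.symm.trans hq)
  rw [← hq1, map_one] at hq0
  exact one_ne_zero hq0

theorem IsAcyclic.isLocallySurjective [CharZero K] {Γ : Multiquiver V E} (hΓ : Γ.IsAcyclic) :
    Γ.IsLocallySurjective K :=
  fun g => (Γ.map_algPart_eq_part_iff K g).2 (hΓ.imageIdeal_eq_top K g)

end Multiquiver

end MultiquiverTGW

end

theorem theorem4p10 {K V E : Type*} [Field K] [CharZero K] (Γ : MultiquiverTGW.Multiquiver V E) :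
    Γ.IsLocallySurjective K ↔ Γ.IsAcyclic :=
  ⟨fun h => h.isAcyclic K, fun h => h.isLocallySurjective K⟩
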